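/- Let $M$ be a $4$-dimensional smooth manifold with a Lorentzian metric $g$ of signature $(-,+,+,+)$, and let $\nabla$ be its Levi-Civita covariant derivative. Let $\mathcal G$ be a finite-dimensional real Lie algebra with a symmetric non-degenerate bilinear form $f\cdot k$ (not necessarily positive definite) that is invariant: $f\cdot[k,l]=[f,k]\cdot l$ for all $f,k,l\in\mathcal G$. Let $A=A_i\,dx^i$ be a $\mathcal G$-valued $1$-form and $\Phi$ a $\mathcal G$-valued function on $M$, and let $V:\mathbb R\to\mathbb R$ be $C^\infty$; $g$, $A$, $\Phi$ are of class $C^2$. Indices run over $1,\dots,4$, repeated indices are summed, and indices are raised with $g$. Write $\Phi^2=\Phi\cdot\Phi$, and in local coordinates put $$F_{ij}=\nabla_iA_j-\nabla_jA_i+[A_i,A_j],\qquad \widehat\nabla_i\Phi=\nabla_i\Phi+[A_i,\Phi],$$ and likewise $\widehat\nabla_i T=\nabla_i T+[A_i,T]$ for every $\mathcal G$-valued tensor field $T$. Define the current $J^k=[\Phi,\widehat\nabla^k\Phi]$, the Higgs potential $H(\Phi)=V'(\Phi^2)\Phi$, and the stress-energy tensor $$\rho_{ij}=F_{ik}\cdot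 F_j{}^{k}-\tfrac14 g_{ij}F_{kl}\cdot F^{kl}+\widehat\nabla_i\Phi\cdot\widehat\nabla_j\Phi-\tfrac12 g_{ij}\bigl(\widehat\nabla_k\Phi\cdot\widehat\nabla^k\Phi+V(\Phi^2)\bigr).$$ If, in the domain of a local coordinate system, the Yang--Mills--Higgs system $$\widehat\nabla_iF^{ij}=J^j,\qquad \widehat\nabla_i\widehat\nabla^i\Phi=H(\Phi)$$ is satisfied, then in that domain $$\nabla_i\rho^{ij}=0\quad (j=1,\dots,4)\qquad\text{and}\qquad \widehat\nabla_kJ^k=0 .$$ -/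

import Mathlib

open scoped Manifold ContDiff

noncomputable section

namespace YMH

/-- The coordinate space `ℝ⁴`; indices run over `Fin 4`. -/
abbrev Coord : Type := EuclideanSpace ℝ (Fin 4)

/-- Real functions of the coordinates. -/
abbrev Scal : Type := Coord → ℝ

/-! ### Calculus of real-valued components in local coordinates -/

/-- The partial derivative `∂f/∂xᵏ`. -/
def pderiv (k : Fin 4) (f : Scal) : Scal :=
  fun y => fderiv ℝ f y (EuclideanSpace.single k 1)

/-- The inverse metric `gⁱʲ`, from the components `g_{ij}`. -/
def ginv (g : Fin 4 → Fin 4 → Scal) (i j : Fin 4) : Scal :=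
  fun y => (Matrix.of fun a b => g a b y)⁻¹ i j

/-- Christoffel symbols: `christoffel g k i j` is
`Γᵏ_{ij} = ½ gᵏᵐ (∂_i g_{mj} + ∂_j g_{mi} - ∂_m g_{ij})`. -/
def christoffel (g : Fin 4 → Fin 4 → Scal) (k i j : Fin 4) : Scal :=
  fun y => (1 / 2) * ∑ m, ginv g k m y *
    (pderiv i (g m j) y + pderiv j (g m i) y - pderiv m (g i j) y)

/-- Covariant derivative of a covector, `∇_i w_j = ∂_i w_j - Γᵏ_{ij} w_k`. -/
def covDeriv₁ (g : Fin 4 → Fin 4 → Scal) (w : Fin 4 → Scal) (i j : Fin 4) : Scal :=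
  fun y => pderiv i (w j) y - ∑ k, christoffel g k i j y * w k y

/-- Covariant derivative of a vector, `∇_i Xʲ = ∂_i Xʲ + Γʲ_{ik} Xᵏ`. -/
def covDeriv₁' (g : Fin 4 → Fin 4 → Scal) (X : Fin 4 → Scal) (i j : Fin 4) : Scal :=
  fun y => pderiv i (X j) y + ∑ k, christoffel g j i k y * X k y

/-- Covariant derivative of a twice contravariant tensor,
`∇_i Tʲᵏ = ∂_i Tʲᵏ + Γʲ_{il} Tˡᵏ + Γᵏ_{il} Tʲˡ`. -/
def covDeriv₂' (g : Fin 4 → Fin 4 → Scal) (T : Fin 4 → Fin 4 → Scal) (i j k : Fin 4) : Scal :=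
  fun y => pderiv i (T j k) y + ∑ l, christoffel g j i l y * T l k y
    + ∑ l, christoffel g k i l y * T j l y

/-! ### Lie-algebra-valued fields in local coordinates

A Lie-algebra-valued field is differentiated through its real components in a basis `ε`. -/

section LieValued

variable {𝔤 : Type*} [LieRing 𝔤] [LieAlgebra ℝ 𝔤] {N : ℕ}

/-- The real components `f^I` of a Lie-algebra-valued function. -/
def comp (ε : Module.Basis (Fin N) ℝ 𝔤) (f : Coord → 𝔤) (I : Fin N) : Scal :=
  fun y => ε.repr (f y) I

/-- The Yang–Mills field `F_{ij} = ∇_i A_j - ∇_j A_i + [A_i, A_j]`. -/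
def fieldStrength (ε : Module.Basis (Fin N) ℝ 𝔤) (g : Fin 4 → Fin 4 → Scal)
    (A : Fin 4 → Coord → 𝔤) (i j : Fin 4) : Coord → 𝔤 :=
  fun y => ∑ I, (covDeriv₁ g (fun k => comp ε (A k) I) i j y
      - covDeriv₁ g (fun k => comp ε (A k) I) j i y) • ε I
    + ⁅A i y, A j y⁆

/-- Raising both indices: `Fⁱʲ = gⁱᵃ gʲᵇ F_{ab}`. -/
def fieldStrengthUp (ε : Module.Basis (Fin N) ℝ 𝔤) (g : Fin 4 → Fin 4 → Scal)
    (A : Fin 4 → Coord → 𝔤) (i j : Fin 4) : Coord → 𝔤 :=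
  fun y => ∑ a, ∑ b, (ginv g i a y * ginv g j b y) • fieldStrength ε g A a b y

/-- Raising the second index: `F_jᵏ = gᵏˡ F_{jl}`. -/
def fieldStrengthMixed (ε : Module.Basis (Fin N) ℝ 𝔤) (g : Fin 4 → Fin 4 → Scal)
    (A : Fin 4 → Coord → 𝔤) (j k : Fin 4) : Coord → 𝔤 :=
  fun y => ∑ l, ginv g k l y • fieldStrength ε g A j l y

/-- Gauge covariant derivative of the Higgs field, `∇̂_i Φ = ∂_i Φ + [A_i, Φ]`. -/
def gaugeD (ε : Module.Basis (Fin N) ℝ 𝔤) (A : Fin 4 → Coord → 𝔤) (Φ : Coord → 𝔤)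
    (i : Fin 4) : Coord → 𝔤 :=
  fun y => ∑ I, pderiv i (comp ε Φ I) y • ε I + ⁅A i y, Φ y⁆

/-- `∇̂ᵏ Φ = gᵏʲ ∇̂_j Φ`. -/
def gaugeDUp (ε : Module.Basis (Fin N) ℝ 𝔤) (g : Fin 4 → Fin 4 → Scal)
    (A : Fin 4 → Coord → 𝔤) (Φ : Coord → 𝔤) (k : Fin 4) : Coord → 𝔤 :=
  fun y => ∑ j, ginv g k j y • gaugeD ε A Φ j y

/-- Gauge divergence of a Lie-algebra-valued vector, `∇̂_k Xᵏ = ∇_k Xᵏ + [A_k, Xᵏ]`. -/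
def gaugeDiv₁ (ε : Module.Basis (Fin N) ℝ 𝔤) (g : Fin 4 → Fin 4 → Scal)
    (A : Fin 4 → Coord → 𝔤) (X : Fin 4 → Coord → 𝔤) : Coord → 𝔤 :=
  fun y => ∑ k, (∑ I, covDeriv₁' g (fun l => comp ε (X l) I) k k y • ε I + ⁅A k y, X k y⁆)

/-- Gauge divergence of a Lie-algebra-valued twice contravariant tensor,
`∇̂_i Tⁱʲ = ∇_i Tⁱʲ + [A_i, Tⁱʲ]`. -/
def gaugeDiv₂ (ε : Module.Basis (Fin N) ℝ 𝔤) (g : Fin 4 → Fin 4 → Scal)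
    (A : Fin 4 → Coord → 𝔤) (T : Fin 4 → Fin 4 → Coord → 𝔤) (j : Fin 4) : Coord → 𝔤 :=
  fun y => ∑ i, (∑ I, covDeriv₂' g (fun k l => comp ε (T k l) I) i i j y • ε I
    + ⁅A i y, T i j y⁆)

/-- The current `Jᵏ = [Φ, ∇̂ᵏ Φ]`. -/
def current (ε : Module.Basis (Fin N) ℝ 𝔤) (g : Fin 4 → Fin 4 → Scal)
    (A : Fin 4 → Coord → 𝔤) (Φ : Coord → 𝔤) (k : Fin 4) : Coord → 𝔤 :=
  fun y => ⁅Φ y, gaugeDUp ε g A Φ k y⁆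

/-- The Higgs potential `H(φ) = V'(φ²) φ`, with `φ² = φ · φ`. -/
def higgsPotential (B : LinearMap.BilinForm ℝ 𝔤) (V : ℝ → ℝ) (φ : 𝔤) : 𝔤 :=
  deriv V (B φ φ) • φ

/-- The stress-energy tensor `ρ_{ij} = F_{ik} · F_jᵏ - ¼ g_{ij} F_{kl} · Fᵏˡ + Φ_{ij}`, where
`Φ_{ij} = ∇̂_i Φ · ∇̂_j Φ - ½ g_{ij} (∇̂_k Φ · ∇̂ᵏ Φ + V(Φ²))`. -/
def stressEnergy (B : LinearMap.BilinForm ℝ 𝔤) (V : ℝ → ℝ) (ε : Module.Basis (Fin N) ℝ 𝔤)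
    (g : Fin 4 → Fin 4 → Scal) (A : Fin 4 → Coord → 𝔤) (Φ : Coord → 𝔤) (i j : Fin 4) : Scal :=
  fun y =>
    ∑ k, B (fieldStrength ε g A i k y) (fieldStrengthMixed ε g A j k y)
    - (1 / 4) * g i j y *
        ∑ k, ∑ l, B (fieldStrength ε g A k l y) (fieldStrengthUp ε g A k l y)
    + (B (gaugeD ε A Φ i y) (gaugeD ε A Φ j y)
      - (1 / 2) * g i j y *
        (∑ k, B (gaugeD ε A Φ k y) (gaugeDUp ε g A Φ k y) + V (B (Φ y) (Φ y))))

/-- `ρⁱʲ = gⁱᵃ gʲᵇ ρ_{ab}`. -/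
def stressEnergyUp (B : LinearMap.BilinForm ℝ 𝔤) (V : ℝ → ℝ) (ε : Module.Basis (Fin N) ℝ 𝔤)
    (g : Fin 4 → Fin 4 → Scal) (A : Fin 4 → Coord → 𝔤) (Φ : Coord → 𝔤) (i j : Fin 4) : Scal :=
  fun y => ∑ a, ∑ b, ginv g i a y * ginv g j b y * stressEnergy B V ε g A Φ a b y

/-- The Yang–Mills–Higgs system `∇̂_i Fⁱʲ = Jʲ`, `∇̂_i ∇̂ⁱ Φ = H(Φ)` on a set of coordinate
values. -/
def SatisfiesYMH (B : LinearMap.BilinForm ℝ 𝔤) (V : ℝ → ℝ) (ε : Module.Basis (Fin N) ℝ 𝔤)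
    (g : Fin 4 → Fin 4 → Scal) (A : Fin 4 → Coord → 𝔤) (Φ : Coord → 𝔤) (s : Set Coord) : Prop :=
  ∀ y ∈ s,
    (∀ j, gaugeDiv₂ ε g A (fieldStrengthUp ε g A) j y = current ε g A Φ j y) ∧
    gaugeDiv₁ ε g A (gaugeDUp ε g A Φ) y = higgsPotential B V (Φ y)

end LieValued

/-! ### Fields on a four-dimensional manifold and their components in a chart -/

section OnManifold

variable {M : Type*} [TopologicalSpace M] [ChartedSpace Coord M]

/-- The coordinate vector field `∂/∂xⁱ` of the chart `e`, at the point with coordinates `y`. -/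
def coordVec (e : OpenPartialHomeomorph M Coord) (i : Fin 4) (y : Coord) :
    TangentSpace (𝓡 4) (e.symm y) :=
  mfderiv (𝓡 4) (𝓡 4) e.symm y (EuclideanSpace.single i (1 : ℝ) : Coord)

/-- The components `g_{ij} = g(∂/∂xⁱ, ∂/∂xʲ)` in the chart `e`. -/
def metricComp (g : ∀ p : M, LinearMap.BilinForm ℝ (TangentSpace (𝓡 4) p))
    (e : OpenPartialHomeomorph M Coord) (i j : Fin 4) : Scal :=
  fun y => g (e.symm y) (coordVec e i y) (coordVec e j y)

/-- A Lorentzian metric of signature `(-,+,+,+)` with `C²` components in every chart. -/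
structure IsLorentzMetric (g : ∀ p : M, LinearMap.BilinForm ℝ (TangentSpace (𝓡 4) p)) :
    Prop where
  signature : ∀ p, ∃ b : Module.Basis (Fin 4) ℝ (TangentSpace (𝓡 4) p),
    ∀ i j, g p (b i) (b j) = if i = j then (if i = 0 then -1 else 1) else 0
  contDiffOn : ∀ e ∈ IsManifold.maximalAtlas (𝓡 4) ∞ M,
    ∀ i j, ContDiffOn ℝ 2 (metricComp g e i j) e.target

variable {𝔤 : Type*} [LieRing 𝔤] [LieAlgebra ℝ 𝔤] {N : ℕ}

/-- The components `A_i = A(∂/∂xⁱ)` of a Lie-algebra-valued 1-form in the chart `e`. -/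
def potentialComp (A : ∀ p : M, TangentSpace (𝓡 4) p →ₗ[ℝ] 𝔤)
    (e : OpenPartialHomeomorph M Coord) (i : Fin 4) : Coord → 𝔤 :=
  fun y => A (e.symm y) (coordVec e i y)

/-- The Lie-algebra-valued 1-form `A` has `C²` components in every chart. -/
def IsC2Potential (ε : Module.Basis (Fin N) ℝ 𝔤)
    (A : ∀ p : M, TangentSpace (𝓡 4) p →ₗ[ℝ] 𝔤) : Prop :=
  ∀ e ∈ IsManifold.maximalAtlas (𝓡 4) ∞ M,
    ∀ i I, ContDiffOn ℝ 2 (comp ε (potentialComp A e i) I) e.target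

/-- The Lie-algebra-valued function `Φ` has `C²` components in every chart. -/
def IsC2Higgs (ε : Module.Basis (Fin N) ℝ 𝔤) (Φ : M → 𝔤) : Prop :=
  ∀ e ∈ IsManifold.maximalAtlas (𝓡 4) ∞ M,
    ∀ I, ContDiffOn ℝ 2 (comp ε (Φ ∘ e.symm) I) e.target

end OnManifold

end YMH

end

noncomputable section

namespace YMH

/-! ### Partial derivatives of real functions -/

section Scalar

variable {f h : Scal} {y : Coord} (k : Fin 4)

/-! The statement is local, so everything is computed with components in one chart. Lower the free
index of the stress-energy tensor and take its divergence. By the Leibniz rule for the invariant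
form, `∇_i(Fⁱᵏ·F_{bk}) = (∇̂_iFⁱᵏ)·F_{bk} + Fⁱᵏ·∇̂_iF_{bk}`. The Bianchi identity and the skewness
of `F` turn the last term into `½ Fⁱᵏ·∇̂_bF_{ik} = ¼ ∂_b(F·F)`, which the trace term removes
(`bianchi`, `sum_bianchi`, `mixedDiv_fieldSquare`).

Likewise `∇_i(∇̂ⁱΦ·∇̂_bΦ) = (∇̂_i∇̂ⁱΦ)·∇̂_bΦ + ∇̂ⁱΦ·∇̂_i∇̂_bΦ`. Commuting the two derivatives
produces `½ ∂_b(∇̂Φ·∇̂Φ)`, again removed by a trace term, and the curvature term `∇̂ⁱΦ·[F_{ib},Φ]`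
(`gaugeD_gaugeD`, `mixedDiv_higgs`). By invariance this cancels `Jᵏ·F_{bk}`, and `H(Φ)·∇̂_bΦ` is `½
∂_b V(Φ²)`.

For the current, `∇̂_kJᵏ = [∇̂_kΦ,∇̂ᵏΦ] + [Φ,∇̂_k∇̂ᵏΦ]`. The first bracket vanishes by symmetry of
`g`, the second because `H(Φ)` is a multiple of `Φ`. Differentiating the Yang–Mills equation instead
would involve third derivatives of `A`.

No covariant derivative of a general tensor is needed: `gaugeD` carries no Christoffel symbols, and
the metric enters through `∂_k gⁱʲ` (`pderiv_ginv`) and the symmetry of `Γ`. -/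

theorem pderiv_congr (hfh : f =ᶠ[nhds y] h) : pderiv k f y = pderiv k h y := by
  simp only [pderiv, hfh.fderiv_eq]

theorem pderiv_add (hf : DifferentiableAt ℝ f y) (hh : DifferentiableAt ℝ h y) :
    pderiv k (fun z => f z + h z) y = pderiv k f y + pderiv k h y := by
  simp only [pderiv, fderiv_fun_add hf hh, _root_.add_apply]

theorem pderiv_sub (hf : DifferentiableAt ℝ f y) (hh : DifferentiableAt ℝ h y) :
    pderiv k (fun z => f z - h z) y = pderiv k f y - pderiv k h y := by
  simp only [pderiv, fderiv_fun_sub hf hh, _root_.sub_apply]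

theorem pderiv_mul (hf : DifferentiableAt ℝ f y) (hh : DifferentiableAt ℝ h y) :
    pderiv k (fun z => f z * h z) y = pderiv k f y * h y + f y * pderiv k h y := by
  simp only [pderiv, fderiv_fun_mul hf hh, _root_.add_apply,
    _root_.smul_apply, smul_eq_mul]
  ring

theorem pderiv_sum {ι : Type*} (s : Finset ι) {f : ι → Scal}
    (hf : ∀ i ∈ s, DifferentiableAt ℝ (f i) y) :
    pderiv k (fun z => ∑ i ∈ s, f i z) y = ∑ i ∈ s, pderiv k (f i) y := by
  simp only [pderiv, fderiv_fun_sum hf, _root_.sum_apply]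

theorem pderiv_const (c : ℝ) : pderiv k (fun _ => c) y = 0 := by
  simp [pderiv]

theorem pderiv_const_mul (c : ℝ) (hf : DifferentiableAt ℝ f y) :
    pderiv k (fun z => c * f z) y = c * pderiv k f y := by
  rw [pderiv_mul k (differentiableAt_const c) hf, pderiv_const]
  ring

theorem pderiv_mul_const (c : ℝ) (hf : DifferentiableAt ℝ f y) :
    pderiv k (fun z => f z * c) y = pderiv k f y * c := by
  rw [pderiv_mul k hf (differentiableAt_const c), pderiv_const]
  ring

theorem pderiv_comp {V : ℝ → ℝ} (hV : DifferentiableAt ℝ V (f y)) (hf : DifferentiableAt ℝ f y) :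
    pderiv k (fun z => V (f z)) y = deriv V (f y) * pderiv k f y := by
  have := (hV.hasDerivAt.comp_hasFDerivAt y hf.hasFDerivAt).fderiv
  simp only [pderiv, Function.comp_def] at this ⊢
  rw [this]
  simp

theorem differentiableAt_pderiv (hf : ContDiffAt ℝ 2 f y) :
    DifferentiableAt ℝ (pderiv k f) y := by
  have h1 : ContDiffAt ℝ 1 (fderiv ℝ f) y := hf.fderiv_right (by norm_num)
  exact (h1.differentiableAt (by norm_num)).clm_apply (differentiableAt_const _)

theorem pderiv_comm (i j : Fin 4) (hf : ContDiffAt ℝ 2 f y) :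
    pderiv i (pderiv j f) y = pderiv j (pderiv i f) y := by
  have h1 : DifferentiableAt ℝ (fderiv ℝ f) y :=
    (hf.fderiv_right (m := 1) (by norm_num)).differentiableAt (by norm_num)
  have h2 := hf.isSymmSndFDerivAt (by simp)
  have h3 : ∀ v w : Coord, fderiv ℝ (fun z => fderiv ℝ f z v) y w = fderiv ℝ (fderiv ℝ f) y w v := by
    intro v w
    rw [fderiv_clm_apply h1 (differentiableAt_const v)]
    simp
  unfold pderiv
  rw [h3, h3]
  exact h2.eq _ _

end Scalar

/-! ### Partial and gauge derivatives of Lie-algebra-valued functions -/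

section LieValued

variable {𝔤 : Type*} [LieRing 𝔤] [LieAlgebra ℝ 𝔤] {N : ℕ} (ε : Module.Basis (Fin N) ℝ 𝔤)

/-- The partial derivative of a Lie-algebra-valued function. -/
def pderivLie (k : Fin 4) (f : Coord → 𝔤) : Coord → 𝔤 :=
  fun y => ∑ I, pderiv k (comp ε f I) y • ε I

/-- Differentiability of the components of a Lie-algebra-valued function. -/
def LieDiffAt (f : Coord → 𝔤) (y : Coord) : Prop :=
  ∀ I, DifferentiableAt ℝ (comp ε f I) y

variable {ε} {f h : Coord → 𝔤} {y : Coord} (k : Fin 4)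

/-- The operator makes sense for any Lie-algebra-valued function. Below it is applied to single
components such as `F_{ij}` and `∇̂_jΦ`, where it is the gauge derivative stripped of its
Christoffel terms. -/
theorem gaugeD_eq (A : Fin 4 → Coord → 𝔤) (f : Coord → 𝔤) :
    gaugeD ε A f k = fun y => pderivLie ε k f y + ⁅A k y, f y⁆ := rfl

theorem comp_pderivLie (f : Coord → 𝔤) (I : Fin N) :
    comp ε (pderivLie ε k f) I = pderiv k (comp ε f I) := by
  funext y
  simp [comp, pderivLie, Finsupp.single_apply]

theorem eq_sum_comp (f : Coord → 𝔤) (y : Coord) : f y = ∑ I, comp ε f I y • ε I :=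
  (ε.sum_repr (f y)).symm

/-- Expansion in the basis reduces differentiability and the Leibniz rule to products of real
functions, so that no norm on `𝔤` is required. The bracket is covered too, one component at a time,
through `bracketForm`. -/
theorem bilin_comp_eq (β : LinearMap.BilinForm ℝ 𝔤) (f h : Coord → 𝔤) :
    (fun z => β (f z) (h z)) =
      fun z => ∑ I, ∑ J, comp ε f I z * comp ε h J z * β (ε I) (ε J) := by
  funext z
  conv_lhs => rw [eq_sum_comp (ε := ε) f z, eq_sum_comp (ε := ε) h z]
  simp only [map_sum, LinearMap.sum_apply, map_smul, LinearMap.smul_apply, smul_eq_mul]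
  rw [Finset.sum_comm]
  refine Finset.sum_congr rfl fun I _ => ?_
  rw [Finset.mul_sum]
  exact Finset.sum_congr rfl fun J _ => by ring

theorem LieDiffAt.bilin (hf : LieDiffAt ε f y) (hh : LieDiffAt ε h y)
    (β : LinearMap.BilinForm ℝ 𝔤) : DifferentiableAt ℝ (fun z => β (f z) (h z)) y := by
  rw [bilin_comp_eq (ε := ε) β f h]
  exact DifferentiableAt.fun_sum fun I _ => DifferentiableAt.fun_sum fun J _ =>
    ((hf I).mul (hh J)).mul_const _

theorem pderiv_bilin (hf : LieDiffAt ε f y) (hh : LieDiffAt ε h y)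
    (β : LinearMap.BilinForm ℝ 𝔤) :
    pderiv k (fun z => β (f z) (h z)) y
      = β (pderivLie ε k f y) (h y) + β (f y) (pderivLie ε k h y) := by
  have e1 := congrFun (bilin_comp_eq (ε := ε) β (pderivLie ε k f) h) y
  have e2 := congrFun (bilin_comp_eq (ε := ε) β f (pderivLie ε k h)) y
  simp only [comp_pderivLie] at e1 e2
  rw [e1, e2, bilin_comp_eq (ε := ε) β f h, pderiv_sum, ← Finset.sum_add_distrib]
  · refine Finset.sum_congr rfl fun I _ => ?_
    rw [pderiv_sum, ← Finset.sum_add_distrib]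
    · refine Finset.sum_congr rfl fun J _ => ?_
      rw [pderiv_mul_const k _ ((hf I).fun_mul (hh J)), pderiv_mul k (hf I) (hh J)]
      ring
    · exact fun J _ => ((hf I).mul (hh J)).mul_const _
  · exact fun I _ => DifferentiableAt.fun_sum fun J _ => ((hf I).mul (hh J)).mul_const _

/-- The `I`-th component of the bracket, as a bilinear form. -/
def bracketForm (ε : Module.Basis (Fin N) ℝ 𝔤) (I : Fin N) : LinearMap.BilinForm ℝ 𝔤 :=
  LinearMap.mk₂ ℝ (fun x z => ε.repr ⁅x, z⁆ I) (by simp) (by simp) (by simp) (by simp)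

theorem comp_lie (f h : Coord → 𝔤) (I : Fin N) :
    comp ε (fun z => ⁅f z, h z⁆) I = fun z => bracketForm ε I (f z) (h z) := rfl

theorem LieDiffAt.lie (hf : LieDiffAt ε f y) (hh : LieDiffAt ε h y) :
    LieDiffAt ε (fun z => ⁅f z, h z⁆) y := fun I => by
  rw [comp_lie]
  exact hf.bilin hh _

theorem LieDiffAt.add (hf : LieDiffAt ε f y) (hh : LieDiffAt ε h y) :
    LieDiffAt ε (fun z => f z + h z) y := fun I => by
  have : comp ε (fun z => f z + h z) I = fun z => comp ε f I z + comp ε h I z := by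
    funext z; simp [comp]
  rw [this]
  exact (hf I).add (hh I)

theorem LieDiffAt.sub (hf : LieDiffAt ε f y) (hh : LieDiffAt ε h y) :
    LieDiffAt ε (fun z => f z - h z) y := fun I => by
  have : comp ε (fun z => f z - h z) I = fun z => comp ε f I z - comp ε h I z := by
    funext z; simp [comp]
  rw [this]
  exact (hf I).sub (hh I)

theorem comp_smul (c : Scal) (f : Coord → 𝔤) (I : Fin N) :
    comp ε (fun z => c z • f z) I = fun z => c z * comp ε f I z := by
  funext z; simp [comp]

theorem comp_sum {ι : Type*} (s : Finset ι) (f : ι → Coord → 𝔤) (I : Fin N) :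
    comp ε (fun z => ∑ i ∈ s, f i z) I = fun z => ∑ i ∈ s, comp ε (f i) I z := by
  funext z; simp [comp]

theorem LieDiffAt.smul {c : Scal} (hc : DifferentiableAt ℝ c y) (hf : LieDiffAt ε f y) :
    LieDiffAt ε (fun z => c z • f z) y := fun I => by
  rw [comp_smul]
  exact hc.mul (hf I)

theorem LieDiffAt.sum {ι : Type*} (s : Finset ι) {f : ι → Coord → 𝔤}
    (hf : ∀ i ∈ s, LieDiffAt ε (f i) y) : LieDiffAt ε (fun z => ∑ i ∈ s, f i z) y := fun I => by
  rw [comp_sum]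
  exact DifferentiableAt.fun_sum fun i hi => hf i hi I

theorem comp_congr (hfh : f =ᶠ[nhds y] h) (I : Fin N) : comp ε f I =ᶠ[nhds y] comp ε h I :=
  hfh.mono fun z hz => by simp only [comp, hz]

theorem LieDiffAt.congr (hf : LieDiffAt ε f y) (hfh : h =ᶠ[nhds y] f) : LieDiffAt ε h y :=
  fun I => (hf I).congr_of_eventuallyEq (comp_congr hfh I)

theorem pderivLie_congr (hfh : f =ᶠ[nhds y] h) : pderivLie ε k f y = pderivLie ε k h y :=
  Finset.sum_congr rfl fun I _ => by rw [pderiv_congr k (comp_congr hfh I)]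

theorem eq_of_comp_eq {f h : Coord → 𝔤} (H : ∀ I, comp ε f I y = comp ε h I y) : f y = h y :=
  ε.ext_elem H

theorem pderivLie_add (hf : LieDiffAt ε f y) (hh : LieDiffAt ε h y) :
    pderivLie ε k (fun z => f z + h z) y = pderivLie ε k f y + pderivLie ε k h y := by
  simp only [pderivLie, ← Finset.sum_add_distrib, ← add_smul]
  refine Finset.sum_congr rfl fun I _ => ?_
  rw [← pderiv_add k (hf I) (hh I)]
  congr 2; funext z; simp [comp]

theorem pderivLie_sub (hf : LieDiffAt ε f y) (hh : LieDiffAt ε h y) :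
    pderivLie ε k (fun z => f z - h z) y = pderivLie ε k f y - pderivLie ε k h y := by
  simp only [pderivLie, ← Finset.sum_sub_distrib, ← sub_smul]
  refine Finset.sum_congr rfl fun I _ => ?_
  rw [← pderiv_sub k (hf I) (hh I)]
  congr 2; funext z; simp [comp]

theorem pderivLie_lie (hf : LieDiffAt ε f y) (hh : LieDiffAt ε h y) :
    pderivLie ε k (fun z => ⁅f z, h z⁆) y
      = ⁅pderivLie ε k f y, h y⁆ + ⁅f y, pderivLie ε k h y⁆ := by
  refine eq_of_comp_eq (ε := ε) (f := pderivLie ε k (fun z => ⁅f z, h z⁆))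
    (h := fun y => ⁅pderivLie ε k f y, h y⁆ + ⁅f y, pderivLie ε k h y⁆) fun I => ?_
  rw [comp_pderivLie, comp_lie, pderiv_bilin k hf hh]
  simp [comp, bracketForm]

theorem differentiable_pderivLie (hf : ∀ I, ContDiffAt ℝ 2 (comp ε f I) y) :
    LieDiffAt ε (pderivLie ε k f) y := fun I => by
  rw [comp_pderivLie]
  exact differentiableAt_pderiv k (hf I)

theorem lieDiffAt_of_contDiffAt (hf : ∀ I, ContDiffAt ℝ 2 (comp ε f I) y) :
    LieDiffAt ε f y := fun I => (hf I).differentiableAt (by norm_num)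

theorem pderivLie_comm (i j : Fin 4) (hf : ∀ I, ContDiffAt ℝ 2 (comp ε f I) y) :
    pderivLie ε i (pderivLie ε j f) y = pderivLie ε j (pderivLie ε i f) y :=
  Finset.sum_congr rfl fun I _ => by
    rw [comp_pderivLie, comp_pderivLie, pderiv_comm i j (hf I)]

variable (A : Fin 4 → Coord → 𝔤)

theorem gaugeD_smul {c : Scal} (hc : DifferentiableAt ℝ c y) (hf : LieDiffAt ε f y) :
    gaugeD ε A (fun z => c z • f z) k y = pderiv k c y • f y + c y • gaugeD ε A f k y := by
  have h1 : pderivLie ε k (fun z => c z • f z) y = pderiv k c y • f y + c y • pderivLie ε k f y := by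
    conv_rhs => rw [eq_sum_comp (ε := ε) f y]
    simp only [pderivLie, comp_smul, Finset.smul_sum, smul_smul, ← Finset.sum_add_distrib,
      ← add_smul]
    exact Finset.sum_congr rfl fun I _ => by rw [pderiv_mul k hc (hf I)]
  simp only [gaugeD_eq, h1, lie_smul, smul_add, add_assoc]

theorem gaugeD_sum {ι : Type*} (s : Finset ι) {f : ι → Coord → 𝔤}
    (hf : ∀ i ∈ s, LieDiffAt ε (f i) y) :
    gaugeD ε A (fun z => ∑ i ∈ s, f i z) k y = ∑ i ∈ s, gaugeD ε A (f i) k y := by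
  simp only [gaugeD_eq, Finset.sum_add_distrib, lie_sum, pderivLie]
  congr 1
  rw [Finset.sum_comm]
  refine Finset.sum_congr rfl fun I _ => ?_
  rw [comp_sum, pderiv_sum k s fun i hi => hf i hi I, Finset.sum_smul]

/-- By the Jacobi identity, `[A_k, ·]` is a derivation of the bracket. -/
theorem gaugeD_lie (hf : LieDiffAt ε f y) (hh : LieDiffAt ε h y) :
    gaugeD ε A (fun z => ⁅f z, h z⁆) k y
      = ⁅gaugeD ε A f k y, h y⁆ + ⁅f y, gaugeD ε A h k y⁆ := by
  simp only [gaugeD_eq, pderivLie_lie k hf hh, add_lie, lie_add, leibniz_lie (A k y) (f y) (h y)]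
  abel

/-- Leibniz rule for an invariant bilinear form. -/
theorem pderiv_invariant {B : LinearMap.BilinForm ℝ 𝔤}
    (hBinv : ∀ f k l : 𝔤, B f ⁅k, l⁆ = B ⁅f, k⁆ l)
    (hf : LieDiffAt ε f y) (hh : LieDiffAt ε h y) :
    pderiv k (fun z => B (f z) (h z)) y
      = B (gaugeD ε A f k y) (h y) + B (f y) (gaugeD ε A h k y) := by
  -- Invariance makes `[A_k, ·]` skew for `B`, so the two connection terms cancel.
  have : B ⁅A k y, f y⁆ (h y) = - B (f y) ⁅A k y, h y⁆ := by
    rw [hBinv, ← lie_skew (A k y) (f y), map_neg, LinearMap.neg_apply]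
  simp only [pderiv_bilin k hf hh, gaugeD_eq, map_add, LinearMap.add_apply, this]
  ring

end LieValued

/-! ### Metrics in local coordinates -/

/-- A `C²` pseudo-Riemannian metric on an open set of coordinate values. -/
structure IsRegularMetricOn (g : Fin 4 → Fin 4 → Scal) (s : Set Coord) : Prop where
  isOpen : IsOpen s
  symm : ∀ y ∈ s, ∀ i j, g i j y = g j i y
  det_ne_zero : ∀ y ∈ s, (Matrix.of fun a b => g a b y).det ≠ 0
  contDiffOn : ∀ i j, ContDiffOn ℝ 2 (g i j) s

namespace IsRegularMetricOn

variable {g : Fin 4 → Fin 4 → Scal} {s : Set Coord} {y : Coord}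

theorem ginv_mul (hg : IsRegularMetricOn g s) (hy : y ∈ s) (i j : Fin 4) :
    ∑ a, ginv g i a y * g a j y = if i = j then 1 else 0 := by
  have h := Matrix.nonsing_inv_mul (Matrix.of fun a b => g a b y)
    (isUnit_iff_ne_zero.2 (hg.det_ne_zero y hy))
  simpa [Matrix.mul_apply, Matrix.one_apply, ginv] using congrFun (congrFun h i) j

theorem mul_ginv (hg : IsRegularMetricOn g s) (hy : y ∈ s) (i j : Fin 4) :
    ∑ a, g i a y * ginv g a j y = if i = j then 1 else 0 := by
  have h := Matrix.mul_nonsing_inv (Matrix.of fun a b => g a b y)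
    (isUnit_iff_ne_zero.2 (hg.det_ne_zero y hy))
  simpa [Matrix.mul_apply, Matrix.one_apply, ginv] using congrFun (congrFun h i) j

theorem ginv_symm (hg : IsRegularMetricOn g s) (hy : y ∈ s) (i j : Fin 4) :
    ginv g i j y = ginv g j i y := by
  have h : Matrix.transpose (Matrix.of fun a b => g a b y) = Matrix.of fun a b => g a b y := by
    ext a b
    simp [hg.symm y hy b a]
  have h2 := Matrix.transpose_nonsing_inv (Matrix.of fun a b => g a b y)
  rw [h] at h2
  exact (congrFun (congrFun h2 j) i)

theorem differentiableAt (hg : IsRegularMetricOn g s) (hy : y ∈ s) (i j : Fin 4) :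
    DifferentiableAt ℝ (g i j) y :=
  ((hg.contDiffOn i j).contDiffAt (hg.isOpen.mem_nhds hy)).differentiableAt (by norm_num)

theorem eventually_mem (hg : IsRegularMetricOn g s) (hy : y ∈ s) : ∀ᶠ z in nhds y, z ∈ s :=
  hg.isOpen.mem_nhds hy

theorem differentiableAt_ginv (hg : IsRegularMetricOn g s) (hy : y ∈ s) (i j : Fin 4) :
    DifferentiableAt ℝ (ginv g i j) y := by
  have hdet : ∀ m : Fin 4 → Fin 4 → Scal, (∀ a b, DifferentiableAt ℝ (m a b) y) →
      DifferentiableAt ℝ (fun z => (Matrix.of fun a b => m a b z).det) y := by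
    intro m hm
    simp only [Matrix.det_apply, Matrix.of_apply]
    refine DifferentiableAt.fun_sum fun σ _ => DifferentiableAt.const_smul ?_ _
    simp only [Fin.prod_univ_four]
    exact (((hm _ _).fun_mul (hm _ _)).fun_mul (hm _ _)).fun_mul (hm _ _)
  -- Cramer's rule: the adjugate entry is the determinant with row `j` replaced by the `i`-th unit
  -- vector.
  have hinv : ginv g i j = fun z => ((Matrix.of fun a b => g a b z).det)⁻¹ *
      (Matrix.of fun a b => (if a = j then (Pi.single i (1 : ℝ) : Fin 4 → ℝ) b else g a b z)).det := by
    funext z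
    simp only [ginv, Matrix.inv_def, Matrix.smul_apply, Ring.inverse_eq_inv', smul_eq_mul,
      Matrix.adjugate_apply]
    congr 2
    ext a b
    by_cases h : a = j
    · subst h; simp
    · simp [h]
  rw [hinv]
  refine ((hdet _ (hg.differentiableAt hy)).inv (hg.det_ne_zero y hy)).mul
    (hdet (fun a b z => if a = j then (Pi.single i (1 : ℝ) : Fin 4 → ℝ) b else g a b z) ?_)
  intro a b
  by_cases h : a = j
  · simp [h]
  · simpa [h] using hg.differentiableAt hy a b

theorem pderiv_symm (hg : IsRegularMetricOn g s) (hy : y ∈ s) (k i j : Fin 4) :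
    pderiv k (g i j) y = pderiv k (g j i) y :=
  pderiv_congr k ((hg.eventually_mem hy).mono fun z hz => hg.symm z hz i j)

theorem christoffel_symm (hg : IsRegularMetricOn g s) (hy : y ∈ s) (k i j : Fin 4) :
    christoffel g k i j y = christoffel g k j i y := by
  simp only [christoffel]
  congr 1
  refine Finset.sum_congr rfl fun m _ => ?_
  rw [hg.pderiv_symm hy m i j]
  ring

/-- Differentiate `g⁻¹g = 1`, then multiply on the right by `g⁻¹`. -/
theorem pderiv_ginv_eq (hg : IsRegularMetricOn g s) (hy : y ∈ s) (k i j : Fin 4) :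
    pderiv k (ginv g i j) y
      = - ∑ a, ∑ b, ginv g i a y * ginv g j b y * pderiv k (g a b) y := by
  have key : ∀ b, ∑ a, pderiv k (ginv g i a) y * g a b y
      = - ∑ a, ginv g i a y * pderiv k (g a b) y := by
    intro b
    have h1 : pderiv k (fun z => ∑ a, ginv g i a z * g a b z) y = 0 := by
      rw [pderiv_congr k (h := fun _ => if i = b then 1 else 0)
        ((hg.eventually_mem hy).mono fun z hz => hg.ginv_mul hz i b), pderiv_const]
    rw [pderiv_sum k _ fun a _ =>
      (hg.differentiableAt_ginv hy i a).fun_mul (hg.differentiableAt hy a b)] at h1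
    simp only [pderiv_mul k (hg.differentiableAt_ginv hy i _) (hg.differentiableAt hy _ b),
      Finset.sum_add_distrib] at h1
    linarith
  calc pderiv k (ginv g i j) y
      = ∑ a, pderiv k (ginv g i a) y * ∑ b, g a b y * ginv g b j y := by
        simp [hg.mul_ginv hy]
    _ = ∑ b, (∑ a, pderiv k (ginv g i a) y * g a b y) * ginv g b j y := by
        simp only [Finset.mul_sum, Finset.sum_mul]
        rw [Finset.sum_comm]
        exact Finset.sum_congr rfl fun b _ => Finset.sum_congr rfl fun a _ => by ring
    _ = _ := by
        simp only [key, neg_mul, Finset.sum_neg_distrib, Finset.sum_mul]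
        rw [Finset.sum_comm]
        congr 1
        refine Finset.sum_congr rfl fun a _ => Finset.sum_congr rfl fun b _ => ?_
        rw [hg.ginv_symm hy b j]
        ring

/-- The inverse metric is parallel. -/
theorem pderiv_ginv (hg : IsRegularMetricOn g s) (hy : y ∈ s) (k i j : Fin 4) :
    pderiv k (ginv g i j) y = - ∑ l, christoffel g i k l y * ginv g l j y
      - ∑ l, christoffel g j k l y * ginv g i l y := by
  have h1 : ∑ l, christoffel g i k l y * ginv g l j y = (1 / 2) * ∑ a, ∑ b,
      ginv g i a y * ginv g j b y *
        (pderiv k (g a b) y + pderiv b (g a k) y - pderiv a (g k b) y) := by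
    simp only [christoffel, Finset.mul_sum, Finset.sum_mul]
    rw [Finset.sum_comm]
    refine Finset.sum_congr rfl fun a _ => Finset.sum_congr rfl fun b _ => ?_
    rw [hg.ginv_symm hy b j]
    ring
  have h2 : ∑ l, christoffel g j k l y * ginv g i l y = (1 / 2) * ∑ a, ∑ b,
      ginv g i a y * ginv g j b y *
        (pderiv k (g a b) y + pderiv a (g k b) y - pderiv b (g a k) y) := by
    simp only [christoffel, Finset.mul_sum, Finset.sum_mul]
    refine Finset.sum_congr rfl fun a _ => Finset.sum_congr rfl fun b _ => ?_
    rw [hg.pderiv_symm hy k b a, hg.pderiv_symm hy a b k, hg.pderiv_symm hy b k a]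
    ring
  -- The last two derivatives of `g` occur in `h1` and `h2` with opposite signs; only `∂_k g_{ab}`
  -- survives the addition.
  rw [hg.pderiv_ginv_eq hy, h1, h2, ← neg_add', ← mul_add, ← Finset.sum_add_distrib]
  simp only [← Finset.sum_add_distrib, Finset.mul_sum]
  congr 1
  exact Finset.sum_congr rfl fun a _ => Finset.sum_congr rfl fun b _ => by ring

/-- Contraction of `∂_k gⁱʲ` with a symmetric tensor. -/
theorem sum_pderiv_ginv_mul (hg : IsRegularMetricOn g s) (hy : y ∈ s) (k : Fin 4)
    {S : Fin 4 → Fin 4 → ℝ} (hS : ∀ a b, S a b = S b a) :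
    ∑ i, ∑ j, pderiv k (ginv g i j) y * S i j
      = -2 * ∑ i, ∑ a, christoffel g a i k y * ∑ c, ginv g i c y * S c a := by
  have h1 : ∑ i, ∑ j, (∑ l, christoffel g i k l y * ginv g l j y) * S i j
      = ∑ i, ∑ a, christoffel g a i k y * ∑ c, ginv g i c y * S c a := by
    conv_rhs => rw [Finset.sum_comm]
    refine Finset.sum_congr rfl fun i _ => ?_
    simp only [Finset.mul_sum, Finset.sum_mul]
    rw [Finset.sum_comm]
    refine Finset.sum_congr rfl fun l _ => Finset.sum_congr rfl fun j _ => ?_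
    rw [hg.christoffel_symm hy i k l, hS i j]
    ring
  -- Symmetry of `S` makes both Christoffel terms of `∂_k gⁱʲ` contribute equally, whence the factor
  -- 2.
  have h2 : ∑ i, ∑ j, (∑ l, christoffel g j k l y * ginv g i l y) * S i j
      = ∑ i, ∑ j, (∑ l, christoffel g i k l y * ginv g l j y) * S i j := by
    rw [Finset.sum_comm]
    refine Finset.sum_congr rfl fun a _ => Finset.sum_congr rfl fun b _ => ?_
    rw [hS b a]
    congr 1
    exact Finset.sum_congr rfl fun l _ => by rw [hg.ginv_symm hy b l]
  simp only [hg.pderiv_ginv hy, sub_mul, neg_mul, Finset.sum_sub_distrib, Finset.sum_neg_distrib,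
    h1, h2]
  ring

end IsRegularMetricOn

/-! ### Divergences -/

section Divergence

variable {g : Fin 4 → Fin 4 → Scal} {s : Set Coord} {y : Coord}

/-- The divergence `∇_i Sⁱ_b` of a mixed tensor. -/
def mixedDiv (g : Fin 4 → Fin 4 → Scal) (S : Fin 4 → Fin 4 → Scal) (b : Fin 4) : Scal :=
  fun y => ∑ i, pderiv i (S i b) y + ∑ i, ∑ a, christoffel g i i a y * S a b y
    - ∑ i, ∑ a, christoffel g a i b y * S i a y

/-- Raising an index commutes with the divergence because `g⁻¹` is parallel. It therefore suffices
to treat the mixed tensor, in which the trace terms become multiples of the Kronecker delta. -/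
theorem div_raise (hg : IsRegularMetricOn g s) (hy : y ∈ s) {S : Fin 4 → Fin 4 → Scal}
    (hS : ∀ i b, DifferentiableAt ℝ (S i b) y) (j : Fin 4) :
    ∑ i, covDeriv₂' g (fun i j z => ∑ b, ginv g j b z * S i b z) i i j y
      = ∑ b, ginv g j b y * mixedDiv g S b y := by
  have h1 : ∀ i, pderiv i (fun z => ∑ b, ginv g j b z * S i b z) y
      = ∑ b, ginv g j b y * pderiv i (S i b) y
        - ∑ b, (∑ a, christoffel g a i b y * S i a y) * ginv g j b y
        - ∑ l, christoffel g j i l y * ∑ b, ginv g l b y * S i b y := by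
    intro i
    rw [pderiv_sum i _ fun b _ => (hg.differentiableAt_ginv hy j b).fun_mul (hS i b)]
    simp only [pderiv_mul i (hg.differentiableAt_ginv hy j _) (hS i _), hg.pderiv_ginv hy, sub_mul,
      neg_mul, Finset.sum_add_distrib, Finset.sum_sub_distrib, Finset.sum_neg_distrib]
    have e1 : ∑ b, (∑ l, christoffel g j i l y * ginv g l b y) * S i b y
        = ∑ l, christoffel g j i l y * ∑ b, ginv g l b y * S i b y := by
      simp only [Finset.mul_sum, Finset.sum_mul]
      rw [Finset.sum_comm]
      exact Finset.sum_congr rfl fun _ _ => Finset.sum_congr rfl fun _ _ => by ring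
    have e2 : ∑ b, (∑ l, christoffel g b i l y * ginv g j l y) * S i b y
        = ∑ b, (∑ a, christoffel g a i b y * S i a y) * ginv g j b y := by
      simp only [Finset.sum_mul]
      rw [Finset.sum_comm]
      exact Finset.sum_congr rfl fun _ _ => Finset.sum_congr rfl fun _ _ => by ring
    rw [e1, e2]
    ring
  have h2 : ∑ i, ∑ b, ginv g j b y * pderiv i (S i b) y
      = ∑ b, ginv g j b y * ∑ i, pderiv i (S i b) y := by
    rw [Finset.sum_comm]
    simp only [Finset.mul_sum]
  have h3 : ∑ i, ∑ b, (∑ a, christoffel g a i b y * S i a y) * ginv g j b y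
      = ∑ b, ginv g j b y * ∑ i, ∑ a, christoffel g a i b y * S i a y := by
    rw [Finset.sum_comm]
    refine Finset.sum_congr rfl fun b _ => ?_
    rw [Finset.mul_sum]
    exact Finset.sum_congr rfl fun i _ => mul_comm _ _
  have h4 : ∑ i, ∑ l, christoffel g i i l y * ∑ b, ginv g j b y * S l b y
      = ∑ b, ginv g j b y * ∑ i, ∑ a, christoffel g i i a y * S a b y := by
    simp only [Finset.mul_sum]
    conv_rhs => rw [Finset.sum_comm]
    refine Finset.sum_congr rfl fun i _ => ?_
    rw [Finset.sum_comm]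
    exact Finset.sum_congr rfl fun _ _ => Finset.sum_congr rfl fun _ _ => by ring
  simp only [covDeriv₂', h1, mixedDiv, Finset.sum_add_distrib, Finset.sum_sub_distrib, mul_add,
    mul_sub, h2, h3, h4]
  ring

theorem mixedDiv_congr {S T : Fin 4 → Fin 4 → Scal} (h : ∀ i b, S i b =ᶠ[nhds y] T i b)
    (b : Fin 4) : mixedDiv g S b y = mixedDiv g T b y := by
  simp only [mixedDiv, fun i b => pderiv_congr i (h i b), fun i b => (h i b).eq_of_nhds]

theorem mixedDiv_add {S T : Fin 4 → Fin 4 → Scal} (hS : ∀ i b, DifferentiableAt ℝ (S i b) y)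
    (hT : ∀ i b, DifferentiableAt ℝ (T i b) y) (b : Fin 4) :
    mixedDiv g (fun i b z => S i b z + T i b z) b y = mixedDiv g S b y + mixedDiv g T b y := by
  simp only [mixedDiv, fun i => pderiv_add i (hS i b) (hT i b), mul_add, Finset.sum_add_distrib]
  ring

/-- Both Christoffel terms equal the trace `Γⁱ_{ib} f` and cancel. -/
theorem mixedDiv_kronecker {f : Scal} (hf : DifferentiableAt ℝ f y) (b : Fin 4) :
    mixedDiv g (fun i b z => (if i = b then 1 else 0) * f z) b y = pderiv b f y := by
  simp only [mixedDiv, fun i (c : ℝ) => pderiv_const_mul i c hf]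
  simp

/-- The divergence of a mixed tensor obtained from a symmetric tensor. -/
theorem mixedDiv_of_symm (hg : IsRegularMetricOn g s) (hy : y ∈ s) {R S : Fin 4 → Fin 4 → Scal}
    (hR : ∀ a b, R a b y = R b a y) (hS : ∀ i b, S i b y = ∑ a, ginv g i a y * R a b y)
    (b : Fin 4) :
    mixedDiv g S b y = ∑ i, pderiv i (S i b) y + ∑ i, ∑ a, christoffel g i i a y * S a b y
      + (1 / 2) * ∑ i, ∑ j, pderiv b (ginv g i j) y * R i j y := by
  -- The Christoffel term of the free index is traded for `½ ∂_b gⁱʲ R_{ij}`, the form in which it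
  -- meets the derivative of the inverse metrics inside `F·F` and `∇̂Φ·∇̂Φ`.
  rw [hg.sum_pderiv_ginv_mul hy b hR]
  simp only [mixedDiv, ← hS]
  ring

end Divergence

/-! ### Gauge divergences written with `gaugeD` and Christoffel symbols -/

section GaugeDivergence

variable {𝔤 : Type*} [LieRing 𝔤] [LieAlgebra ℝ 𝔤] {N : ℕ} {ε : Module.Basis (Fin N) ℝ 𝔤}
  (g : Fin 4 → Fin 4 → Scal) (A : Fin 4 → Coord → 𝔤)

theorem gaugeDiv₁_eq (X : Fin 4 → Coord → 𝔤) (y : Coord) :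
    gaugeDiv₁ ε g A X y
      = ∑ k, gaugeD ε A (X k) k y + ∑ k, ∑ l, christoffel g k k l y • X l y := by
  have h : ∀ k, ∑ l, christoffel g k k l y • X l y
      = ∑ I, (∑ l, christoffel g k k l y * comp ε (X l) I y) • ε I := by
    intro k
    simp only [Finset.sum_smul, mul_smul]
    rw [Finset.sum_comm]
    refine Finset.sum_congr rfl fun l _ => ?_
    rw [← Finset.smul_sum, ← eq_sum_comp]
  simp only [gaugeDiv₁, gaugeD, covDeriv₁', h, ← Finset.sum_add_distrib, add_smul]
  refine Finset.sum_congr rfl fun k _ => ?_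
  rw [Finset.sum_add_distrib]
  abel

theorem gaugeDiv₂_eq (T : Fin 4 → Fin 4 → Coord → 𝔤) (j : Fin 4) (y : Coord) :
    gaugeDiv₂ ε g A T j y
      = ∑ i, gaugeD ε A (T i j) i y + ∑ i, ∑ l, christoffel g i i l y • T l j y
        + ∑ i, ∑ l, christoffel g j i l y • T i l y := by
  have h : ∀ i m (X : Fin 4 → Coord → 𝔤), ∑ l, christoffel g m i l y • X l y
      = ∑ I, (∑ l, christoffel g m i l y * comp ε (X l) I y) • ε I := by
    intro i m X
    simp only [Finset.sum_smul, mul_smul]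
    rw [Finset.sum_comm]
    refine Finset.sum_congr rfl fun l _ => ?_
    rw [← Finset.smul_sum, ← eq_sum_comp]
  simp only [fun i => h i i (fun l => T l j), fun i => h i j (T i)]
  simp only [gaugeDiv₂, gaugeD, covDeriv₂', ← Finset.sum_add_distrib, add_smul]
  refine Finset.sum_congr rfl fun k _ => ?_
  simp only [Finset.sum_add_distrib]
  abel

theorem eq_zero_of_eq_neg {E : Type*} [AddCommGroup E] [Module ℝ E] {x : E} (h : x = -x) :
    x = 0 := by
  have h2 : (2 : ℝ) • x = 0 := by
    rw [two_smul]
    exact eq_neg_iff_add_eq_zero.1 h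
  exact (smul_eq_zero.1 h2).resolve_left two_ne_zero

/-- The term `Γʲ_{il} Tⁱˡ` contracts a symmetric with a skew object and vanishes. -/
theorem gaugeDiv₂_of_skew {s : Set Coord} {y : Coord} (hg : IsRegularMetricOn g s) (hy : y ∈ s)
    {T : Fin 4 → Fin 4 → Coord → 𝔤} (hT : ∀ i j, T i j y = - T j i y) (j : Fin 4) :
    gaugeDiv₂ ε g A T j y
      = ∑ i, gaugeD ε A (T i j) i y + ∑ i, ∑ l, christoffel g i i l y • T l j y := by
  rw [gaugeDiv₂_eq, add_eq_left]
  refine eq_zero_of_eq_neg ?_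
  conv_lhs => rw [Finset.sum_comm]
  simp only [← Finset.sum_neg_distrib]
  refine Finset.sum_congr rfl fun i _ => Finset.sum_congr rfl fun l _ => ?_
  rw [hg.christoffel_symm hy, hT l i, smul_neg]

end GaugeDivergence

/-! ### Identities for the gauge fields -/

section Fields

variable {𝔤 : Type*} [LieRing 𝔤] [LieAlgebra ℝ 𝔤] {N : ℕ} {ε : Module.Basis (Fin N) ℝ 𝔤}
  {g : Fin 4 → Fin 4 → Scal} {A : Fin 4 → Coord → 𝔤} {Φ : Coord → 𝔤} {s : Set Coord} {y : Coord}

theorem contDiffAt_of_isRegularMetricOn (hg : IsRegularMetricOn g s) {f : Scal}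
    (hf : ContDiffOn ℝ 2 f s) (hy : y ∈ s) : ContDiffAt ℝ 2 f y :=
  hf.contDiffAt (hg.isOpen.mem_nhds hy)

/-- The connection is torsion-free, so the Christoffel terms cancel and `F` does not depend on the
metric. -/
theorem fieldStrength_eq (hg : IsRegularMetricOn g s) (hy : y ∈ s) (i j : Fin 4) :
    fieldStrength ε g A i j y
      = pderivLie ε i (A j) y - pderivLie ε j (A i) y + ⁅A i y, A j y⁆ := by
  simp only [fieldStrength, covDeriv₁, pderivLie, ← Finset.sum_sub_distrib, ← sub_smul,
    fun k => hg.christoffel_symm hy k i j]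
  congr 1
  exact Finset.sum_congr rfl fun I _ => by congr 1; ring

theorem fieldStrength_eventuallyEq (hg : IsRegularMetricOn g s) (hy : y ∈ s) (i j : Fin 4) :
    fieldStrength ε g A i j =ᶠ[nhds y]
      fun z => pderivLie ε i (A j) z - pderivLie ε j (A i) z + ⁅A i z, A j z⁆ :=
  (hg.eventually_mem hy).mono fun _ hz => fieldStrength_eq hg hz i j

theorem fieldStrength_skew (hg : IsRegularMetricOn g s) (hy : y ∈ s) (i j : Fin 4) :
    fieldStrength ε g A i j y = - fieldStrength ε g A j i y := by
  rw [fieldStrength_eq hg hy, fieldStrength_eq hg hy, ← lie_skew]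
  abel

theorem lieDiffAt_potential (hg : IsRegularMetricOn g s)
    (hA : ∀ i I, ContDiffOn ℝ 2 (comp ε (A i) I) s) (hy : y ∈ s) (i : Fin 4) :
    LieDiffAt ε (A i) y :=
  lieDiffAt_of_contDiffAt fun I => contDiffAt_of_isRegularMetricOn hg (hA i I) hy

theorem lieDiffAt_pderivLie_potential (hg : IsRegularMetricOn g s)
    (hA : ∀ i I, ContDiffOn ℝ 2 (comp ε (A i) I) s) (hy : y ∈ s) (i j : Fin 4) :
    LieDiffAt ε (pderivLie ε i (A j)) y :=
  differentiable_pderivLie i fun I => contDiffAt_of_isRegularMetricOn hg (hA j I) hy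

theorem lieDiffAt_fieldStrength (hg : IsRegularMetricOn g s)
    (hA : ∀ i I, ContDiffOn ℝ 2 (comp ε (A i) I) s) (hy : y ∈ s) (i j : Fin 4) :
    LieDiffAt ε (fieldStrength ε g A i j) y :=
  (((lieDiffAt_pderivLie_potential hg hA hy i j).sub
    (lieDiffAt_pderivLie_potential hg hA hy j i)).add
    ((lieDiffAt_potential hg hA hy i).lie (lieDiffAt_potential hg hA hy j))).congr
    (fieldStrength_eventuallyEq hg hy i j)

theorem gaugeD_fieldStrength (hg : IsRegularMetricOn g s)
    (hA : ∀ i I, ContDiffOn ℝ 2 (comp ε (A i) I) s) (hy : y ∈ s) (k i j : Fin 4) :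
    gaugeD ε A (fieldStrength ε g A i j) k y
      = pderivLie ε k (pderivLie ε i (A j)) y - pderivLie ε k (pderivLie ε j (A i)) y
        + (⁅pderivLie ε k (A i) y, A j y⁆ + ⁅A i y, pderivLie ε k (A j) y⁆)
        + ⁅A k y, pderivLie ε i (A j) y - pderivLie ε j (A i) y + ⁅A i y, A j y⁆⁆ := by
  have hd := lieDiffAt_pderivLie_potential hg hA hy
  have ha := lieDiffAt_potential hg hA hy
  rw [gaugeD_eq]
  simp only []
  rw [pderivLie_congr k (fieldStrength_eventuallyEq hg hy i j), fieldStrength_eq hg hy,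
    pderivLie_add k ((hd i j).sub (hd j i)) ((ha i).lie (ha j)), pderivLie_sub k (hd i j) (hd j i),
    pderivLie_lie k (ha i) (ha j)]

/-- The Bianchi identity. -/
theorem bianchi (hg : IsRegularMetricOn g s)
    (hA : ∀ i I, ContDiffOn ℝ 2 (comp ε (A i) I) s) (hy : y ∈ s) (i j k : Fin 4) :
    gaugeD ε A (fieldStrength ε g A j k) i y + gaugeD ε A (fieldStrength ε g A k i) j y
      + gaugeD ε A (fieldStrength ε g A i j) k y = 0 := by
  have hc : ∀ i j l, pderivLie ε i (pderivLie ε j (A l)) y = pderivLie ε j (pderivLie ε i (A l)) y :=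
    fun i j l => pderivLie_comm i j fun I => contDiffAt_of_isRegularMetricOn hg (hA l I) hy
  simp only [gaugeD_fieldStrength hg hA hy, lie_add, lie_sub]
  -- Second derivatives of `A` cancel by symmetry, brackets of `A` with first derivatives cancel by
  -- skewness, and what is left is the Jacobi identity.
  rw [hc j i k, hc k i j, hc k j i,
    ← lie_skew (pderivLie ε i (A j) y), ← lie_skew (pderivLie ε j (A k) y),
    ← lie_skew (pderivLie ε k (A i) y)]
  have := lie_jacobi (A i y) (A j y) (A k y)
  rw [← this]
  abel

theorem lieDiffAt_higgs (hg : IsRegularMetricOn g s)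
    (hΦ : ∀ I, ContDiffOn ℝ 2 (comp ε Φ I) s) (hy : y ∈ s) : LieDiffAt ε Φ y :=
  lieDiffAt_of_contDiffAt fun I => contDiffAt_of_isRegularMetricOn hg (hΦ I) hy

theorem lieDiffAt_gaugeD (hg : IsRegularMetricOn g s)
    (hA : ∀ i I, ContDiffOn ℝ 2 (comp ε (A i) I) s)
    (hΦ : ∀ I, ContDiffOn ℝ 2 (comp ε Φ I) s) (hy : y ∈ s) (i : Fin 4) : LieDiffAt ε (gaugeD ε A Φ i) y :=
  (differentiable_pderivLie i fun I => contDiffAt_of_isRegularMetricOn hg (hΦ I) hy).add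
    ((lieDiffAt_potential hg hA hy i).lie (lieDiffAt_higgs hg hΦ hy))

/-- Curvature measures the failure of gauge derivatives to commute. Beyond symmetry of second
derivatives, only the Leibniz rule and the Jacobi identity are involved. -/
theorem gaugeD_gaugeD (hg : IsRegularMetricOn g s)
    (hA : ∀ i I, ContDiffOn ℝ 2 (comp ε (A i) I) s)
    (hΦ : ∀ I, ContDiffOn ℝ 2 (comp ε Φ I) s) (hy : y ∈ s) (i j : Fin 4) :
    gaugeD ε A (gaugeD ε A Φ j) i y - gaugeD ε A (gaugeD ε A Φ i) j y
      = ⁅fieldStrength ε g A i j y, Φ y⁆ := by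
  have hΦy := fun I => contDiffAt_of_isRegularMetricOn hg (hΦ I) hy
  have hd := fun i => differentiable_pderivLie (ε := ε) i hΦy
  have ha := lieDiffAt_potential hg hA hy
  have hp := lieDiffAt_higgs hg hΦ hy
  have h1 : ∀ i j, gaugeD ε A (gaugeD ε A Φ j) i y = pderivLie ε i (pderivLie ε j Φ) y
      + (⁅pderivLie ε i (A j) y, Φ y⁆ + ⁅A j y, pderivLie ε i Φ y⁆)
      + ⁅A i y, pderivLie ε j Φ y + ⁅A j y, Φ y⁆⁆ := by
    intro i j
    rw [← pderivLie_lie i (ha j) hp, ← pderivLie_add i (hd j) ((ha j).lie hp)]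
    rfl
  rw [h1, h1, fieldStrength_eq hg hy, pderivLie_comm j i hΦy]
  simp only [lie_add, add_lie, sub_lie, lie_lie]
  abel

end Fields

/-! ### Divergence of the stress-energy tensor and of the current -/

section Conservation

variable {𝔤 : Type*} [LieRing 𝔤] [LieAlgebra ℝ 𝔤] {N : ℕ} {ε : Module.Basis (Fin N) ℝ 𝔤}
  {g : Fin 4 → Fin 4 → Scal} {A : Fin 4 → Coord → 𝔤} {Φ : Coord → 𝔤} {s : Set Coord} {y : Coord}
  {B : LinearMap.BilinForm ℝ 𝔤}

theorem lieDiffAt_fieldStrengthUp (hg : IsRegularMetricOn g s)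
    (hA : ∀ i I, ContDiffOn ℝ 2 (comp ε (A i) I) s) (hy : y ∈ s) (i j : Fin 4) :
    LieDiffAt ε (fieldStrengthUp ε g A i j) y :=
  LieDiffAt.sum _ fun a _ => LieDiffAt.sum _ fun b _ => LieDiffAt.smul
    ((hg.differentiableAt_ginv hy i a).fun_mul (hg.differentiableAt_ginv hy j b))
    (lieDiffAt_fieldStrength hg hA hy a b)

theorem lieDiffAt_gaugeDUp (hg : IsRegularMetricOn g s)
    (hA : ∀ i I, ContDiffOn ℝ 2 (comp ε (A i) I) s) (hΦ : ∀ I, ContDiffOn ℝ 2 (comp ε Φ I) s)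
    (hy : y ∈ s) (i : Fin 4) : LieDiffAt ε (gaugeDUp ε g A Φ i) y :=
  LieDiffAt.sum _ fun j _ => LieDiffAt.smul (hg.differentiableAt_ginv hy i j)
    (lieDiffAt_gaugeD hg hA hΦ hy j)

theorem sum_sum_sum_sum_comm {ι E : Type*} [Fintype ι] [AddCommMonoid E] (f : ι → ι → ι → ι → E) :
    ∑ k, ∑ l, ∑ a, ∑ c, f k l a c = ∑ a, ∑ c, ∑ k, ∑ l, f k l a c := by
  have := Finset.sum_comm (s := (Finset.univ : Finset (ι × ι))) (t := (Finset.univ : Finset (ι × ι)))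
    (f := fun p q => f p.1 p.2 q.1 q.2)
  simpa [Fintype.sum_prod_type] using this

theorem fieldStrengthUp_skew (hg : IsRegularMetricOn g s) (hy : y ∈ s) (i j : Fin 4) :
    fieldStrengthUp ε g A i j y = - fieldStrengthUp ε g A j i y := by
  simp only [fieldStrengthUp, ← Finset.sum_neg_distrib]
  rw [Finset.sum_comm]
  refine Finset.sum_congr rfl fun a _ => Finset.sum_congr rfl fun b _ => ?_
  rw [fieldStrength_skew hg hy b a, smul_neg, mul_comm]

/-- The contraction `F_{ak} · F_bᵏ`. -/
def fieldSquare (B : LinearMap.BilinForm ℝ 𝔤) (ε : Module.Basis (Fin N) ℝ 𝔤)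
    (g : Fin 4 → Fin 4 → Scal) (A : Fin 4 → Coord → 𝔤) (a b : Fin 4) : Scal :=
  fun y => ∑ k, B (fieldStrength ε g A a k y) (fieldStrengthMixed ε g A b k y)

theorem fieldSquare_eq (a b : Fin 4) (y : Coord) : fieldSquare B ε g A a b y
    = ∑ k, ∑ l, ginv g k l y * B (fieldStrength ε g A a k y) (fieldStrength ε g A b l y) := by
  simp [fieldSquare, fieldStrengthMixed]

theorem fieldSquare_symm (hg : IsRegularMetricOn g s) (hsymm : ∀ u v, B u v = B v u) (hy : y ∈ s)
    (a b : Fin 4) : fieldSquare B ε g A a b y = fieldSquare B ε g A b a y := by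
  rw [fieldSquare_eq, fieldSquare_eq, Finset.sum_comm]
  refine Finset.sum_congr rfl fun k _ => Finset.sum_congr rfl fun l _ => ?_
  rw [hg.ginv_symm hy l k, hsymm]

theorem sum_ginv_mul_fieldSquare (hg : IsRegularMetricOn g s) (hy : y ∈ s) (i b : Fin 4) :
    ∑ a, ginv g i a y * fieldSquare B ε g A a b y
      = ∑ k, B (fieldStrengthUp ε g A i k y) (fieldStrength ε g A b k y) := by
  simp only [fieldSquare_eq, fieldStrengthUp, map_sum, LinearMap.sum_apply, map_smul,
    LinearMap.smul_apply, smul_eq_mul, Finset.mul_sum]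
  conv_rhs => rw [Finset.sum_comm]
  refine Finset.sum_congr rfl fun a _ => ?_
  rw [Finset.sum_comm]
  refine Finset.sum_congr rfl fun k _ => Finset.sum_congr rfl fun l _ => ?_
  rw [hg.ginv_symm hy l k]
  ring

/-- The contraction `F_{kl} · Fᵏˡ`. -/
def fieldNormSq (B : LinearMap.BilinForm ℝ 𝔤) (ε : Module.Basis (Fin N) ℝ 𝔤)
    (g : Fin 4 → Fin 4 → Scal) (A : Fin 4 → Coord → 𝔤) : Scal :=
  fun y => ∑ k, ∑ l, B (fieldStrength ε g A k l y) (fieldStrengthUp ε g A k l y)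

theorem differentiableAt_fieldNormSq (hg : IsRegularMetricOn g s)
    (hA : ∀ i I, ContDiffOn ℝ 2 (comp ε (A i) I) s) (hy : y ∈ s) :
    DifferentiableAt ℝ (fieldNormSq B ε g A) y :=
  DifferentiableAt.fun_sum fun k _ => DifferentiableAt.fun_sum fun l _ =>
    (lieDiffAt_fieldStrength hg hA hy k l).bilin (lieDiffAt_fieldStrengthUp hg hA hy k l) B

/-- `F·F` contains two inverse metrics and two copies of `F`. Each pair contributes equally: the
first by skewness of `F` (`e2`), the second by moving indices across the product (`e3`) and symmetry
of `B`. -/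
theorem pderiv_fieldNormSq (hg : IsRegularMetricOn g s)
    (hA : ∀ i I, ContDiffOn ℝ 2 (comp ε (A i) I) s) (hsymm : ∀ u v, B u v = B v u)
    (hBinv : ∀ f k l : 𝔤, B f ⁅k, l⁆ = B ⁅f, k⁆ l) (hy : y ∈ s) (b : Fin 4) :
    pderiv b (fieldNormSq B ε g A) y
      = 2 * ∑ i, ∑ j, pderiv b (ginv g i j) y * fieldSquare B ε g A i j y
        + 2 * ∑ k, ∑ l, B (fieldStrengthUp ε g A k l y)
            (gaugeD ε A (fieldStrength ε g A k l) b y) := by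
  have hF := lieDiffAt_fieldStrength hg hA hy
  have hP := lieDiffAt_fieldStrengthUp hg hA hy
  have hu := hg.differentiableAt_ginv hy
  have hD : ∀ k l, gaugeD ε A (fieldStrengthUp ε g A k l) b y
      = ∑ a, ∑ c, (pderiv b (ginv g k a) y * ginv g l c y) • fieldStrength ε g A a c y
        + ∑ a, ∑ c, (ginv g k a y * pderiv b (ginv g l c) y) • fieldStrength ε g A a c y
        + ∑ a, ∑ c, (ginv g k a y * ginv g l c y) •
            gaugeD ε A (fieldStrength ε g A a c) b y := by
    intro k l
    have h1 : ∀ a c, LieDiffAt ε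
        (fun z => (ginv g k a z * ginv g l c z) • fieldStrength ε g A a c z) y :=
      fun a c => LieDiffAt.smul ((hu k a).fun_mul (hu l c)) (hF a c)
    unfold fieldStrengthUp
    rw [gaugeD_sum b A _ fun a _ => LieDiffAt.sum _ fun c _ => h1 a c]
    simp only [← Finset.sum_add_distrib]
    refine Finset.sum_congr rfl fun a _ => ?_
    rw [gaugeD_sum b A _ fun c _ => h1 a c]
    refine Finset.sum_congr rfl fun c _ => ?_
    rw [gaugeD_smul b A ((hu k a).fun_mul (hu l c)) (hF a c), pderiv_mul b (hu k a) (hu l c),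
      add_smul]
  have e1 : ∑ k, ∑ l, B (fieldStrength ε g A k l y)
      (∑ a, ∑ c, (pderiv b (ginv g k a) y * ginv g l c y) • fieldStrength ε g A a c y)
      = ∑ i, ∑ j, pderiv b (ginv g i j) y * fieldSquare B ε g A i j y := by
    simp only [fieldSquare_eq, map_sum, map_smul, smul_eq_mul, Finset.mul_sum]
    refine Finset.sum_congr rfl fun k _ => ?_
    rw [Finset.sum_comm]
    exact Finset.sum_congr rfl fun _ _ => Finset.sum_congr rfl fun _ _ =>
      Finset.sum_congr rfl fun _ _ => by ring
  have e2 : ∑ k, ∑ l, B (fieldStrength ε g A k l y)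
      (∑ a, ∑ c, (ginv g k a y * pderiv b (ginv g l c) y) • fieldStrength ε g A a c y)
      = ∑ k, ∑ l, B (fieldStrength ε g A k l y)
      (∑ a, ∑ c, (pderiv b (ginv g k a) y * ginv g l c y) • fieldStrength ε g A a c y) := by
    rw [Finset.sum_comm]
    refine Finset.sum_congr rfl fun k _ => Finset.sum_congr rfl fun l _ => ?_
    rw [Finset.sum_comm, fieldStrength_skew hg hy l k, map_neg, LinearMap.neg_apply, ← map_neg]
    simp only [← Finset.sum_neg_distrib, ← smul_neg]
    congr 1
    refine Finset.sum_congr rfl fun a _ => Finset.sum_congr rfl fun c _ => ?_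
    rw [fieldStrength_skew hg hy c a, neg_neg, mul_comm]
  have e3 : ∑ k, ∑ l, B (fieldStrength ε g A k l y)
      (∑ a, ∑ c, (ginv g k a y * ginv g l c y) • gaugeD ε A (fieldStrength ε g A a c) b y)
      = ∑ k, ∑ l, B (fieldStrengthUp ε g A k l y) (gaugeD ε A (fieldStrength ε g A k l) b y) := by
    simp only [fieldStrengthUp, map_sum, map_smul, smul_eq_mul, LinearMap.sum_apply,
      LinearMap.smul_apply]
    rw [sum_sum_sum_sum_comm]
    refine Finset.sum_congr rfl fun a _ => Finset.sum_congr rfl fun c _ =>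
      Finset.sum_congr rfl fun k _ => Finset.sum_congr rfl fun l _ => ?_
    rw [hg.ginv_symm hy k a, hg.ginv_symm hy l c]
  have h2 : pderiv b (fieldNormSq B ε g A) y = ∑ k, ∑ l,
      (B (gaugeD ε A (fieldStrength ε g A k l) b y) (fieldStrengthUp ε g A k l y)
        + B (fieldStrength ε g A k l y) (gaugeD ε A (fieldStrengthUp ε g A k l) b y)) := by
    unfold fieldNormSq
    rw [pderiv_sum b _ fun k _ => DifferentiableAt.fun_sum fun l _ => (hF k l).bilin (hP k l) B]
    refine Finset.sum_congr rfl fun k _ => ?_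
    rw [pderiv_sum b _ fun l _ => (hF k l).bilin (hP k l) B]
    exact Finset.sum_congr rfl fun l _ => pderiv_invariant b A hBinv (hF k l) (hP k l)
  simp only [h2, hD, map_add, Finset.sum_add_distrib]
  rw [e2, e1, e3]
  simp only [fun k l => hsymm (gaugeD ε A (fieldStrength ε g A k l) b y)]
  ring

/-- Contracted with the skew `Fⁱᵏ`, two of the three Bianchi terms become equal (`h1`), and their
sum is the third (`h2`); hence the factor `½`. -/
theorem sum_bianchi (hg : IsRegularMetricOn g s)
    (hA : ∀ i I, ContDiffOn ℝ 2 (comp ε (A i) I) s) (hy : y ∈ s) (b : Fin 4) :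
    ∑ i, ∑ k, B (fieldStrengthUp ε g A i k y) (gaugeD ε A (fieldStrength ε g A b k) i y)
      = (1 / 2) * ∑ i, ∑ k, B (fieldStrengthUp ε g A i k y)
          (gaugeD ε A (fieldStrength ε g A i k) b y) := by
  have hneg : ∀ i k l, gaugeD ε A (fieldStrength ε g A i k) l y
      = - gaugeD ε A (fieldStrength ε g A k i) l y := by
    intro i k l
    simp only [gaugeD_fieldStrength hg hA hy, lie_add, lie_sub]
    rw [← lie_skew (A i y) (A k y), ← lie_skew (pderivLie ε l (A k) y) (A i y),
      ← lie_skew (A k y) (pderivLie ε l (A i) y), lie_neg]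
    abel
  have h1 : ∑ i, ∑ k, B (fieldStrengthUp ε g A i k y) (gaugeD ε A (fieldStrength ε g A b k) i y)
      = ∑ i, ∑ k, B (fieldStrengthUp ε g A i k y) (gaugeD ε A (fieldStrength ε g A i b) k y) := by
    rw [Finset.sum_comm]
    refine Finset.sum_congr rfl fun k _ => Finset.sum_congr rfl fun i _ => ?_
    rw [fieldStrengthUp_skew hg hy i k, hneg b k, map_neg, map_neg, LinearMap.neg_apply, neg_neg]
  have h2 : ∑ i, ∑ k, B (fieldStrengthUp ε g A i k y) (gaugeD ε A (fieldStrength ε g A b k) i y)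
      + ∑ i, ∑ k, B (fieldStrengthUp ε g A i k y) (gaugeD ε A (fieldStrength ε g A i b) k y)
      = ∑ i, ∑ k, B (fieldStrengthUp ε g A i k y) (gaugeD ε A (fieldStrength ε g A i k) b y) := by
    simp only [← Finset.sum_add_distrib, ← map_add]
    refine Finset.sum_congr rfl fun i _ => Finset.sum_congr rfl fun k _ => ?_
    congr 1
    rw [hneg i k b]
    exact eq_neg_of_add_eq_zero_left
      ((add_right_comm _ _ _).trans (bianchi hg hA hy i b k))
  linarith

/-- The divergence of the Yang–Mills part of the stress-energy tensor, up to its trace term. -/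
theorem mixedDiv_fieldSquare (hg : IsRegularMetricOn g s)
    (hA : ∀ i I, ContDiffOn ℝ 2 (comp ε (A i) I) s) (hsymm : ∀ u v, B u v = B v u)
    (hBinv : ∀ f k l : 𝔤, B f ⁅k, l⁆ = B ⁅f, k⁆ l) (hy : y ∈ s) (b : Fin 4) :
    mixedDiv g (fun i b z => ∑ k, B (fieldStrengthUp ε g A i k z) (fieldStrength ε g A b k z)) b y
      = ∑ k, B (gaugeDiv₂ ε g A (fieldStrengthUp ε g A) k y) (fieldStrength ε g A b k y)
        + (1 / 4) * pderiv b (fieldNormSq B ε g A) y := by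
  have hF := lieDiffAt_fieldStrength hg hA hy
  have hP := lieDiffAt_fieldStrengthUp hg hA hy
  -- The term `½ ∂_b gⁱʲ F_{ik}·F_jᵏ` produced here is exactly the inverse-metric part of `¼
  -- ∂_b(F·F)`.
  rw [mixedDiv_of_symm hg hy (fieldSquare_symm (ε := ε) (A := A) hg hsymm hy)
    fun i b => (sum_ginv_mul_fieldSquare hg hy i b).symm,
    pderiv_fieldNormSq hg hA hsymm hBinv hy]
  have h1 : ∀ i, pderiv i
      (fun z => ∑ k, B (fieldStrengthUp ε g A i k z) (fieldStrength ε g A b k z)) y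
      = ∑ k, B (gaugeD ε A (fieldStrengthUp ε g A i k) i y) (fieldStrength ε g A b k y)
        + ∑ k, B (fieldStrengthUp ε g A i k y) (gaugeD ε A (fieldStrength ε g A b k) i y) := by
    intro i
    rw [pderiv_sum i _ fun k _ => (hP i k).bilin (hF b k) B, ← Finset.sum_add_distrib]
    exact Finset.sum_congr rfl fun k _ => pderiv_invariant i A hBinv (hP i k) (hF b k)
  have h2 : ∑ k, B (gaugeDiv₂ ε g A (fieldStrengthUp ε g A) k y) (fieldStrength ε g A b k y)
      = ∑ i, ∑ k, B (gaugeD ε A (fieldStrengthUp ε g A i k) i y) (fieldStrength ε g A b k y)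
        + ∑ i, ∑ a, christoffel g i i a y *
            ∑ k, B (fieldStrengthUp ε g A a k y) (fieldStrength ε g A b k y) := by
    have hd := gaugeDiv₂_of_skew (ε := ε) (T := fieldStrengthUp ε g A) g A hg hy
      (fieldStrengthUp_skew hg hy)
    simp only [hd, map_add, map_sum, map_smul,
      LinearMap.add_apply, LinearMap.sum_apply, LinearMap.smul_apply, smul_eq_mul,
      Finset.sum_add_distrib, Finset.mul_sum]
    refine congrArg₂ (· + ·) ?_ ?_
    · rw [Finset.sum_comm]
    · rw [Finset.sum_comm]
      refine Finset.sum_congr rfl fun i _ => ?_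
      rw [Finset.sum_comm]
  simp only [h1, h2, Finset.sum_add_distrib, sum_bianchi hg hA hy b]
  ring

/-- The contraction `∇̂_kΦ · ∇̂ᵏΦ`. -/
def kineticTerm (B : LinearMap.BilinForm ℝ 𝔤) (ε : Module.Basis (Fin N) ℝ 𝔤)
    (g : Fin 4 → Fin 4 → Scal) (A : Fin 4 → Coord → 𝔤) (Φ : Coord → 𝔤) : Scal :=
  fun y => ∑ k, B (gaugeD ε A Φ k y) (gaugeDUp ε g A Φ k y)

theorem differentiableAt_kineticTerm (hg : IsRegularMetricOn g s)
    (hA : ∀ i I, ContDiffOn ℝ 2 (comp ε (A i) I) s) (hΦ : ∀ I, ContDiffOn ℝ 2 (comp ε Φ I) s)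
    (hy : y ∈ s) : DifferentiableAt ℝ (kineticTerm B ε g A Φ) y :=
  DifferentiableAt.fun_sum fun k _ =>
    (lieDiffAt_gaugeD hg hA hΦ hy k).bilin (lieDiffAt_gaugeDUp hg hA hΦ hy k) B

theorem pderiv_kineticTerm (hg : IsRegularMetricOn g s)
    (hA : ∀ i I, ContDiffOn ℝ 2 (comp ε (A i) I) s) (hΦ : ∀ I, ContDiffOn ℝ 2 (comp ε Φ I) s)
    (hsymm : ∀ u v, B u v = B v u) (hBinv : ∀ f k l : 𝔤, B f ⁅k, l⁆ = B ⁅f, k⁆ l)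
    (hy : y ∈ s) (b : Fin 4) :
    pderiv b (kineticTerm B ε g A Φ) y
      = ∑ i, ∑ j, pderiv b (ginv g i j) y * B (gaugeD ε A Φ i y) (gaugeD ε A Φ j y)
        + 2 * ∑ i, B (gaugeDUp ε g A Φ i y) (gaugeD ε A (gaugeD ε A Φ i) b y) := by
  have hW := lieDiffAt_gaugeD hg hA hΦ hy
  have hX := lieDiffAt_gaugeDUp hg hA hΦ hy
  have hu := hg.differentiableAt_ginv hy
  have hD : ∀ k, gaugeD ε A (gaugeDUp ε g A Φ k) b y
      = ∑ j, pderiv b (ginv g k j) y • gaugeD ε A Φ j y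
        + ∑ j, ginv g k j y • gaugeD ε A (gaugeD ε A Φ j) b y := by
    intro k
    unfold gaugeDUp
    rw [gaugeD_sum b A _ fun j _ => LieDiffAt.smul (hu k j) (hW j), ← Finset.sum_add_distrib]
    exact Finset.sum_congr rfl fun j _ => gaugeD_smul b A (hu k j) (hW j)
  have e1 : ∑ k, ∑ j, ginv g k j y * B (gaugeD ε A Φ k y) (gaugeD ε A (gaugeD ε A Φ j) b y)
      = ∑ i, B (gaugeDUp ε g A Φ i y) (gaugeD ε A (gaugeD ε A Φ i) b y) := by
    simp only [gaugeDUp, map_sum, map_smul, smul_eq_mul, LinearMap.sum_apply, LinearMap.smul_apply]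
    rw [Finset.sum_comm]
    refine Finset.sum_congr rfl fun i _ => Finset.sum_congr rfl fun k _ => ?_
    rw [hg.ginv_symm hy]
  unfold kineticTerm
  rw [pderiv_sum b _ fun k _ => (hW k).bilin (hX k) B]
  simp only [fun k => pderiv_invariant b A hBinv (hW k) (hX k), hD, map_add, map_sum, map_smul,
    smul_eq_mul, Finset.sum_add_distrib, e1, fun k => hsymm (gaugeD ε A (gaugeD ε A Φ k) b y)]
  ring

/-- The divergence of the Higgs part of the stress-energy tensor, up to its trace term. -/
theorem mixedDiv_higgs (hg : IsRegularMetricOn g s)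
    (hA : ∀ i I, ContDiffOn ℝ 2 (comp ε (A i) I) s) (hΦ : ∀ I, ContDiffOn ℝ 2 (comp ε Φ I) s)
    (hsymm : ∀ u v, B u v = B v u) (hBinv : ∀ f k l : 𝔤, B f ⁅k, l⁆ = B ⁅f, k⁆ l)
    (hy : y ∈ s) (b : Fin 4) :
    mixedDiv g (fun i b z => B (gaugeDUp ε g A Φ i z) (gaugeD ε A Φ b z)) b y
      = B (gaugeDiv₁ ε g A (gaugeDUp ε g A Φ) y) (gaugeD ε A Φ b y)
        + ∑ i, B (gaugeDUp ε g A Φ i y) ⁅fieldStrength ε g A i b y, Φ y⁆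
        + (1 / 2) * pderiv b (kineticTerm B ε g A Φ) y := by
  have hW := lieDiffAt_gaugeD hg hA hΦ hy
  have hX := lieDiffAt_gaugeDUp hg hA hΦ hy
  rw [mixedDiv_of_symm (R := fun i j z => B (gaugeD ε A Φ i z) (gaugeD ε A Φ j z)) hg hy
    (fun a b => hsymm _ _) fun i b => by simp [gaugeDUp],
    pderiv_kineticTerm hg hA hΦ hsymm hBinv hy]
  -- Writing `[F_{ib},Φ]` as a commutator of gauge derivatives leaves a linear identity between
  -- sums.
  simp only [fun i => pderiv_invariant i A hBinv (hX i) (hW b), gaugeDiv₁_eq, map_add, map_sum,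
    map_smul, LinearMap.add_apply, LinearMap.sum_apply, LinearMap.smul_apply, smul_eq_mul,
    ← gaugeD_gaugeD hg hA hΦ hy, map_sub, Finset.sum_add_distrib, Finset.sum_sub_distrib]
  ring

theorem stressEnergy_mixed {V : ℝ → ℝ} (hg : IsRegularMetricOn g s) (hy : y ∈ s) (i b : Fin 4) :
    ∑ a, ginv g i a y * stressEnergy B V ε g A Φ a b y
      = ∑ k, B (fieldStrengthUp ε g A i k y) (fieldStrength ε g A b k y)
        + B (gaugeDUp ε g A Φ i y) (gaugeD ε A Φ b y)
        + (if i = b then 1 else 0) * (-(1 / 4) * fieldNormSq B ε g A y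
          - (1 / 2) * kineticTerm B ε g A Φ y - (1 / 2) * V (B (Φ y) (Φ y))) := by
  -- The Kronecker delta is expanded as `gⁱᵃ g_{ab}` so that both sides can be compared term by term
  -- in `a`.
  rw [← sum_ginv_mul_fieldSquare hg hy, ← hg.ginv_mul hy]
  simp only [gaugeDUp, map_sum, map_smul, smul_eq_mul, LinearMap.sum_apply, LinearMap.smul_apply,
    Finset.sum_mul, ← Finset.sum_add_distrib]
  refine Finset.sum_congr rfl fun a _ => ?_
  simp only [stressEnergy, fieldSquare, fieldNormSq, kineticTerm]
  ring

/-- The stress-energy tensor of a solution of the Yang–Mills–Higgs system is divergence-free. -/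
theorem div_stressEnergyUp {V : ℝ → ℝ} (hV : Differentiable ℝ V) (hg : IsRegularMetricOn g s)
    (hA : ∀ i I, ContDiffOn ℝ 2 (comp ε (A i) I) s) (hΦ : ∀ I, ContDiffOn ℝ 2 (comp ε Φ I) s)
    (hsymm : ∀ u v, B u v = B v u) (hBinv : ∀ f k l : 𝔤, B f ⁅k, l⁆ = B ⁅f, k⁆ l)
    (hYMH : SatisfiesYMH B V ε g A Φ s) (hy : y ∈ s) (j : Fin 4) :
    ∑ i, covDeriv₂' g (stressEnergyUp B V ε g A Φ) i i j y = 0 := by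
  have hF := lieDiffAt_fieldStrength hg hA hy
  have hP := lieDiffAt_fieldStrengthUp hg hA hy
  have hW := lieDiffAt_gaugeD hg hA hΦ hy
  have hX := lieDiffAt_gaugeDUp hg hA hΦ hy
  have hp := lieDiffAt_higgs hg hΦ hy
  have hL := differentiableAt_fieldNormSq (B := B) hg hA hy
  have hK := differentiableAt_kineticTerm (B := B) hg hA hΦ hy
  have hpp := hp.bilin hp B
  have hVp : DifferentiableAt ℝ (fun z => V (B (Φ z) (Φ z))) y :=
    (hV (B (Φ y) (Φ y))).comp y hpp
  have hT1 : ∀ i b, DifferentiableAt ℝ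
      (fun z => ∑ k, B (fieldStrengthUp ε g A i k z) (fieldStrength ε g A b k z)) y :=
    fun i b => DifferentiableAt.fun_sum fun k _ => (hP i k).bilin (hF b k) B
  have hT2 : ∀ i b, DifferentiableAt ℝ
      (fun z => B (gaugeDUp ε g A Φ i z) (gaugeD ε A Φ b z)) y :=
    fun i b => (hX i).bilin (hW b) B
  have ht : DifferentiableAt ℝ (fun z => -(1 / 4) * fieldNormSq B ε g A z
      - (1 / 2) * kineticTerm B ε g A Φ z - (1 / 2) * V (B (Φ z) (Φ z))) y :=
    ((hL.const_mul _).fun_sub (hK.const_mul _)).fun_sub (hVp.const_mul _)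
  have hT3 : ∀ i b : Fin 4, DifferentiableAt ℝ (fun z => (if i = b then (1 : ℝ) else 0) *
      (-(1 / 4) * fieldNormSq B ε g A z - (1 / 2) * kineticTerm B ε g A Φ z
        - (1 / 2) * V (B (Φ z) (Φ z)))) y := fun i b => ht.const_mul _
  have heq : ∀ i b, (fun z => ∑ a, ginv g i a z * stressEnergy B V ε g A Φ a b z) =ᶠ[nhds y] _ :=
    fun i b => (hg.eventually_mem hy).mono fun z hz => stressEnergy_mixed hg hz i b
  have hUp : stressEnergyUp B V ε g A Φ = fun i j z => ∑ b, ginv g j b z *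
      ∑ a, ginv g i a z * stressEnergy B V ε g A Φ a b z := by
    funext i j z
    simp only [stressEnergyUp, Finset.mul_sum]
    rw [Finset.sum_comm]
    exact Finset.sum_congr rfl fun _ _ => Finset.sum_congr rfl fun _ _ => by ring
  rw [hUp, div_raise hg hy (S := fun i b z => ∑ a, ginv g i a z * stressEnergy B V ε g A Φ a b z)
    fun i b => (((hT1 i b).fun_add (hT2 i b)).fun_add (hT3 i b)).congr_of_eventuallyEq (heq i b)]
  refine Finset.sum_eq_zero fun b _ => mul_eq_zero_of_right _ ?_
  -- The force of the current on the gauge field is opposite to the curvature term left by the Higgs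
  -- part: invariance moves the bracket, and skewness of `F` gives the sign.
  have hforce : ∑ k, B ⁅Φ y, gaugeDUp ε g A Φ k y⁆ (fieldStrength ε g A b k y)
      = - ∑ k, B (gaugeDUp ε g A Φ k y) ⁅fieldStrength ε g A k b y, Φ y⁆ := by
    rw [← Finset.sum_neg_distrib]
    refine Finset.sum_congr rfl fun k _ => ?_
    rw [← hBinv, hsymm, fieldStrength_skew hg hy b k, lie_neg, map_neg, LinearMap.neg_apply,
      hBinv (gaugeDUp ε g A Φ k y)]
  have hpot : pderiv b (fun z => V (B (Φ z) (Φ z))) y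
      = 2 * (deriv V (B (Φ y) (Φ y)) * B (Φ y) (gaugeD ε A Φ b y)) := by
    rw [pderiv_comp b (f := fun z => B (Φ z) (Φ z)) (hV _) hpp, pderiv_invariant b A hBinv hp hp,
      hsymm (gaugeD ε A Φ b y)]
    ring
  -- The trace part contributes a pure gradient, cancelling the `¼` and `½` gradients of the two
  -- divergence lemmas. After the field equations are inserted, `hforce` and `hpot` account for the
  -- rest.
  rw [mixedDiv_congr heq, mixedDiv_add (fun i b => (hT1 i b).fun_add (hT2 i b)) hT3,
    mixedDiv_add hT1 hT2, mixedDiv_fieldSquare hg hA hsymm hBinv hy,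
    mixedDiv_higgs hg hA hΦ hsymm hBinv hy, mixedDiv_kronecker ht,
    pderiv_sub b ((hL.const_mul _).fun_sub (hK.const_mul _)) (hVp.const_mul _),
    pderiv_sub b (hL.const_mul _) (hK.const_mul _), pderiv_const_mul b _ hL,
    pderiv_const_mul b _ hK, pderiv_const_mul b _ hVp, hpot, (hYMH y hy).2]
  simp only [(hYMH y hy).1, current, hforce, higgsPotential, map_smul, LinearMap.smul_apply,
    smul_eq_mul]
  ring

/-- The current of a solution of the Yang–Mills–Higgs system is gauge-divergence-free. -/
theorem gaugeDiv₁_current {V : ℝ → ℝ} (hg : IsRegularMetricOn g s)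
    (hA : ∀ i I, ContDiffOn ℝ 2 (comp ε (A i) I) s) (hΦ : ∀ I, ContDiffOn ℝ 2 (comp ε Φ I) s)
    (hYMH : SatisfiesYMH B V ε g A Φ s) (hy : y ∈ s) :
    gaugeDiv₁ ε g A (current ε g A Φ) y = 0 := by
  have hX := lieDiffAt_gaugeDUp hg hA hΦ hy
  have hp := lieDiffAt_higgs hg hΦ hy
  -- A skew bracket is contracted with the symmetric `gᵏʲ`.
  have h1 : ∑ k, ⁅gaugeD ε A Φ k y, gaugeDUp ε g A Φ k y⁆ = 0 := by
    refine eq_zero_of_eq_neg ?_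
    simp only [gaugeDUp, lie_sum, lie_smul, ← Finset.sum_neg_distrib]
    conv_lhs => rw [Finset.sum_comm]
    refine Finset.sum_congr rfl fun i _ => Finset.sum_congr rfl fun k _ => ?_
    rw [hg.ginv_symm hy, ← smul_neg, lie_skew]
  have h2 : ∀ k, gaugeD ε A (current ε g A Φ k) k y
      = ⁅gaugeD ε A Φ k y, gaugeDUp ε g A Φ k y⁆
        + ⁅Φ y, gaugeD ε A (gaugeDUp ε g A Φ k) k y⁆ :=
    fun k => gaugeD_lie k A hp (hX k)
  have h3 : gaugeDiv₁ ε g A (current ε g A Φ) y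
      = ⁅Φ y, gaugeDiv₁ ε g A (gaugeDUp ε g A Φ) y⁆ := by
    rw [gaugeDiv₁_eq, gaugeDiv₁_eq]
    simp only [h2, Finset.sum_add_distrib, h1, zero_add, lie_add, lie_sum, lie_smul, current]
  rw [h3, (hYMH y hy).2]
  simp [higgsPotential]

end Conservation

/-! ### Components of a Lorentzian metric in a chart -/

section Chart

variable {M : Type*} [TopologicalSpace M] [ChartedSpace Coord M]
  {g : ∀ p : M, LinearMap.BilinForm ℝ (TangentSpace (𝓡 4) p)} {e : OpenPartialHomeomorph M Coord}

/-- Symmetry is read off from the diagonal Gram matrix of the orthonormal basis in the signature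
condition. -/
theorem IsLorentzMetric.symm (hg : IsLorentzMetric g) (p : M) (v w : TangentSpace (𝓡 4) p) :
    g p v w = g p w v := by
  obtain ⟨b, hb⟩ := hg.signature p
  have : g p = LinearMap.flip (g p) := by
    refine b.ext fun i => b.ext fun j => ?_
    rw [LinearMap.flip_apply, hb, hb]
    by_cases h : i = j
    · subst h; rfl
    · rw [if_neg h, if_neg (Ne.symm h)]
  conv_lhs => rw [this]
  rfl

theorem IsLorentzMetric.nondegenerate (hg : IsLorentzMetric g) (p : M) : (g p).Nondegenerate := by
  obtain ⟨b, hb⟩ := hg.signature p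
  refine LinearMap.BilinForm.nondegenerate_of_det_ne_zero (g p) b ?_
  have : LinearMap.BilinForm.toMatrix b (g p)
      = Matrix.diagonal fun i => if i = 0 then (-1 : ℝ) else 1 := by
    ext i j
    rw [LinearMap.BilinForm.toMatrix_apply, hb, Matrix.diagonal_apply]
  rw [this, Matrix.det_diagonal, Finset.prod_ne_zero_iff]
  intro i _
  split_ifs <;> norm_num

/-- The basis of coordinate vectors of a chart. -/
theorem exists_basis_coordVec [IsManifold (𝓡 4) ∞ M]
    (he : e ∈ IsManifold.maximalAtlas (𝓡 4) ∞ M) {y : Coord} (hy : y ∈ e.target) :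
    ∃ b : Module.Basis (Fin 4) ℝ (TangentSpace (𝓡 4) (e.symm y)), ∀ i, b i = coordVec e i y := by
  have hd : e.MDifferentiable (𝓡 4) (𝓡 4) :=
    ⟨(contMDiffOn_of_mem_maximalAtlas he).mdifferentiableOn (by simp),
      (contMDiffOn_symm_of_mem_maximalAtlas he).mdifferentiableOn (by simp)⟩
  -- The differential of the inverse chart is a linear isomorphism, so it carries the standard basis
  -- of `ℝ⁴` to a basis.
  let L := hd.symm.mfderiv (x := y) hy
  let b₀ : Module.Basis (Fin 4) ℝ (TangentSpace (𝓡 4) y) :=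
    (EuclideanSpace.basisFun (Fin 4) ℝ).toBasis
  have hb₀ : ∀ i, b₀ i = (EuclideanSpace.single i (1 : ℝ) : Coord) := fun i => by
    change (EuclideanSpace.basisFun (Fin 4) ℝ).toBasis i = _
    rw [OrthonormalBasis.coe_toBasis, EuclideanSpace.basisFun_apply]
  refine ⟨b₀.map L.toLinearEquiv, fun i => ?_⟩
  rw [Module.Basis.map_apply]
  exact congrArg L (hb₀ i)

/-- The local computation needs symmetry and nondegeneracy of the metric, not its signature. The
matrix `g_{ij}` is the Gram matrix in the coordinate basis, hence invertible. -/
theorem IsLorentzMetric.isRegularMetricOn [IsManifold (𝓡 4) ∞ M] (hg : IsLorentzMetric g)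
    (he : e ∈ IsManifold.maximalAtlas (𝓡 4) ∞ M) :
    IsRegularMetricOn (metricComp g e) e.target where
  isOpen := e.open_target
  symm _ _ _ _ := hg.symm _ _ _
  det_ne_zero y hy := by
    obtain ⟨b, hb⟩ := exists_basis_coordVec he hy
    have := (LinearMap.BilinForm.nondegenerate_iff_det_ne_zero b).1 (hg.nondegenerate (e.symm y))
    convert this using 2
    ext i j
    simp [metricComp, LinearMap.BilinForm.toMatrix_apply, hb]
  contDiffOn := hg.contDiffOn e he

end Chart

end YMH

end

/-! ### Conservation laws in a chart of the manifold -/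

theorem mainTheorem11 {M : Type*} [TopologicalSpace M] [ChartedSpace YMH.Coord M]
    [IsManifold (𝓡 4) ∞ M]
    {𝔤 : Type*} [LieRing 𝔤] [LieAlgebra ℝ 𝔤] {N : ℕ} (ε : Module.Basis (Fin N) ℝ 𝔤)
    (B : LinearMap.BilinForm ℝ 𝔤) (hBsymm : B.IsSymm) (hBnondeg : B.Nondegenerate)
    (hBinv : ∀ f k l : 𝔤, B f ⁅k, l⁆ = B ⁅f, k⁆ l)
    (V : ℝ → ℝ) (hV : ContDiff ℝ ∞ V)
    (g : ∀ p : M, LinearMap.BilinForm ℝ (TangentSpace (𝓡 4) p)) (hg : YMH.IsLorentzMetric g)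
    (A : ∀ p : M, TangentSpace (𝓡 4) p →ₗ[ℝ] 𝔤) (hA : YMH.IsC2Potential ε A)
    (Φ : M → 𝔤) (hΦ : YMH.IsC2Higgs ε Φ)
    (e : OpenPartialHomeomorph M YMH.Coord) (he : e ∈ IsManifold.maximalAtlas (𝓡 4) ∞ M)
    (hYMH : YMH.SatisfiesYMH B V ε (YMH.metricComp g e) (YMH.potentialComp A e) (Φ ∘ e.symm)
      e.target) :
    ∀ y ∈ e.target,
      (∀ j : Fin 4, ∑ i : Fin 4, YMH.covDeriv₂' (YMH.metricComp g e)
        (YMH.stressEnergyUp B V ε (YMH.metricComp g e) (YMH.potentialComp A e) (Φ ∘ e.symm))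
        i i j y = 0) ∧
      YMH.gaugeDiv₁ ε (YMH.metricComp g e) (YMH.potentialComp A e)
        (YMH.current ε (YMH.metricComp g e) (YMH.potentialComp A e) (Φ ∘ e.symm)) y = 0 := by
  have hg' := hg.isRegularMetricOn he
  have hsymm : ∀ u v, B u v = B v u := fun u v => hBsymm.eq u v
  exact fun y hy => ⟨fun j => YMH.div_stressEnergyUp (hV.differentiable (by simp)) hg' (hA e he)
    (hΦ e he) hsymm hBinv hYMH hy j, YMH.gaugeDiv₁_current hg' (hA e he) (hΦ e he) hYMH hy⟩
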